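/- Let $A$ be an infinite-dimensional simple unital $C^*$-algebra (simple: $A\neq 0$ and the only closed two-sided ideals of $A$ are $0$ and $A$). Let $\tau$ be an extremal trace of $A$, i.e. an extreme point of the convex set $T(A)$ of tracial states of $A$, and let $\phi_1,\dots,\phi_m$ be pure states of $A$, i.e. extreme points of the state space of $A$. For a state $\phi$ let $(\pi_\phi,H_\phi,\xi_\phi)$ denote its GNS representation with canonical cyclic vector. Put $$M=\{a\in A:\ \pi_{\phi_j}(a)\xi_{\phi_j}=\pi_{\phi_j}(a^*)\xi_{\phi_j}=0\ \text{ for all } j\le m\}.$$ Then $M$ is a hereditary $C^*$-subalgebra of $A$ (a norm-closed $*$-subalgebra, not necessarily unital, such that $0\le a\le b\in M$ implies $a\in M$). Moreover, the von Neumann algebra $\pi_\tau(A)''$ on $H_\tau$ is a $\mathrm{II}_1$ factor (an infinite-dimensional factor in which every isometry is unitary), and $\pi_\tau(M)$ is a strongly dense subset of it, i.e. $\pi_\tau(M)\subseteq\pi_\tau(A)''$ and $\pi_\tau(A)''$ is contained in the closure of $\pi_\tau(M)$ in the strong operator topology. -/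

import Mathlib

open scoped ComplexOrder

/-- A C⋆-algebra is simple if it is nonzero and its only closed two-sided ideals are `0` and the
whole algebra. -/
def IsSimpleCStarAlgebra (A : Type*) [CStarAlgebra A] : Prop :=
  Nontrivial A ∧ ∀ I : TwoSidedIdeal A, IsClosed (I : Set A) → I = ⊥ ∨ I = ⊤

/-- The state space `S(A)`, as a convex set of linear functionals. -/
def stateSpace (A : Type*) [CStarAlgebra A] [PartialOrder A] : Set (A →ₗ[ℂ] ℂ) :=
  {f | (∀ a : A, 0 ≤ a → 0 ≤ f a) ∧ f 1 = 1}

/-- The trace space `T(A)`: the states `f` with `f (a * b) = f (b * a)`. -/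
def traceSpace (A : Type*) [CStarAlgebra A] [PartialOrder A] : Set (A →ₗ[ℂ] ℂ) :=
  {f | f ∈ stateSpace A ∧ ∀ a b : A, f (a * b) = f (b * a)}

/-- A pure state is an extreme point of the state space. -/
def IsPureState {A : Type*} [CStarAlgebra A] [PartialOrder A] (φ : A →ₚ[ℂ] ℂ) : Prop :=
  φ.toLinearMap ∈ Set.extremePoints ℝ (stateSpace A)

/-- An extremal trace is an extreme point of the trace space. -/
def IsExtremalTrace {A : Type*} [CStarAlgebra A] [PartialOrder A] (τ : A →ₚ[ℂ] ℂ) : Prop :=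
  τ.toLinearMap ∈ Set.extremePoints ℝ (traceSpace A)

/-- The canonical cyclic vector `ξ_φ` of the GNS representation: the class of `1`. -/
noncomputable def gnsVector {A : Type*} [CStarAlgebra A] [PartialOrder A] [StarOrderedRing A]
    (φ : A →ₚ[ℂ] ℂ) : φ.GNS :=
  ((φ.toPreGNS 1 : φ.PreGNS) : φ.GNS)

/-- The set of all `a` with `π_{φ_j}(a) ξ_{φ_j} = π_{φ_j}(a⋆) ξ_{φ_j} = 0` for every `j`. -/
def gnsAnnihilator {A : Type*} [CStarAlgebra A] [PartialOrder A] [StarOrderedRing A]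
    {m : ℕ} (φ : Fin m → (A →ₚ[ℂ] ℂ)) : Set A :=
  {a | ∀ j, (φ j).gnsStarAlgHom a (gnsVector (φ j)) = 0 ∧
    (φ j).gnsStarAlgHom (star a) (gnsVector (φ j)) = 0}

/-- `S` is a hereditary C⋆-subalgebra: a norm-closed (not necessarily unital) ⋆-subalgebra that
contains every `a` with `0 ≤ a ≤ b` for some `b ∈ S`. -/
def IsHereditaryCStarSubalgebra {A : Type*} [CStarAlgebra A] [PartialOrder A]
    (S : Set A) : Prop :=
  (∃ B : NonUnitalStarSubalgebra ℂ A, (B : Set A) = S) ∧ IsClosed S ∧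
    ∀ a b : A, 0 ≤ a → a ≤ b → b ∈ S → a ∈ S

/-- The von Neumann algebra `S''` generated by a self-adjoint set `S` of bounded operators
(for general `S`, the bicommutant of `S ∪ S⋆`). -/
noncomputable def bicommutant {H : Type*} [NormedAddCommGroup H] [InnerProductSpace ℂ H]
    [CompleteSpace H] (S : Set (H →L[ℂ] H)) : VonNeumannAlgebra H where
  toStarSubalgebra :=
    StarSubalgebra.centralizer ℂ (StarSubalgebra.centralizer ℂ S : Set (H →L[ℂ] H))
  centralizer_centralizer' := by simp

/-- For a self-adjoint set, `bicommutant` is literally the commutant of the commutant. -/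
theorem coe_bicommutant {H : Type*} [NormedAddCommGroup H] [InnerProductSpace ℂ H]
    [CompleteSpace H] (S : Set (H →L[ℂ] H)) (hS : star S = S) :
    (bicommutant S : Set (H →L[ℂ] H)) = Set.centralizer (Set.centralizer S) := by
  have h : (bicommutant S : Set (H →L[ℂ] H)) =
      (StarSubalgebra.centralizer ℂ (StarSubalgebra.centralizer ℂ S : Set (H →L[ℂ] H)) :
        Set (H →L[ℂ] H)) := rfl
  have h₂ : star (Set.centralizer S) = Set.centralizer S := by rw [Set.star_centralizer, hS]
  rw [h, StarSubalgebra.coe_centralizer, StarSubalgebra.coe_centralizer, hS, Set.union_self, h₂,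
    Set.union_self]

/-- The von Neumann algebra `π_φ(A)''` on the GNS Hilbert space `H_φ`. -/
noncomputable def gnsVonNeumannAlgebra {A : Type*} [CStarAlgebra A] [PartialOrder A]
    [StarOrderedRing A] (φ : A →ₚ[ℂ] ℂ) : VonNeumannAlgebra φ.GNS :=
  bicommutant (Set.range φ.gnsStarAlgHom)

/-- The von Neumann algebra above is the double commutant of the range of `π_φ`. -/
theorem coe_gnsVonNeumannAlgebra {A : Type*} [CStarAlgebra A] [PartialOrder A]
    [StarOrderedRing A] (φ : A →ₚ[ℂ] ℂ) :
    (gnsVonNeumannAlgebra φ : Set (φ.GNS →L[ℂ] φ.GNS)) =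
      Set.centralizer (Set.centralizer (Set.range φ.gnsStarAlgHom)) := by
  refine coe_bicommutant _ (Set.ext fun x => ⟨?_, ?_⟩)
  · rintro ⟨a, ha⟩
    exact ⟨star a, by rw [map_star, ha, star_star]⟩
  · rintro ⟨a, ha⟩
    exact ⟨star a, by rw [map_star, ha]⟩

/-- A `II₁` factor: an infinite-dimensional finite factor. -/
structure IsFactorOfTypeII₁ {H : Type*} [NormedAddCommGroup H] [InnerProductSpace ℂ H]
    [CompleteSpace H] (N : VonNeumannAlgebra H) : Prop where
  /-- The center is trivial. -/
  factor : ∀ x ∈ N, x ∈ N.commutant → ∃ c : ℂ, x = c • (1 : H →L[ℂ] H)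
  /-- Every isometry in `N` is a unitary. -/
  finite : ∀ v ∈ N, star v * v = 1 → v * star v = 1
  infiniteDimensional : ¬ FiniteDimensional ℂ N.toStarSubalgebra

/-- `S` is a strongly dense subset of `N`: it is contained in `N`, and `N` is contained in its
closure for the strong operator topology (pointwise norm convergence on `H`). -/
def IsStronglyDenseIn {H : Type*} [NormedAddCommGroup H] [InnerProductSpace ℂ H]
    [CompleteSpace H] (S : Set (H →L[ℂ] H)) (N : VonNeumannAlgebra H) : Prop :=
  S ⊆ N ∧ ∀ x ∈ N, ContinuousLinearMap.toPointwiseConvergenceCLM ℂ (RingHom.id ℂ) H H x ∈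
    closure (ContinuousLinearMap.toPointwiseConvergenceCLM ℂ (RingHom.id ℂ) H H '' S)

/-! Everything rests on positive contractions `e` in `A` that annihilate all the vectors `ξ_{φ_j}`
while `τ (1 - e)` is as small as desired. Each `e * a * e` then lies in `M`. Since `(1 - e)² ≤ 1 -
e`, the operator `π_τ (1 - e)` is small on the tracial vector; the trace bound `‖π a (π b ξ)‖ ≤ ‖b‖
* ‖π a ξ‖` and density make it small on any given finite set. Thus `e * a * e` approximates `a`
strongly, and von Neumann's density theorem gives density in `π_τ(A)''`.

To build `e`, note that the GNS space of a pure state is infinite-dimensional, because the simple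
infinite-dimensional `A` embeds in its operators. By irreducibility some self-adjoint `a` acts
almost as `diag(0, …, n-1)` on orthonormal vectors `v_i` orthogonal to the unit vector `u` to be
fixed. Bump functions of `a` centred at the integers almost fix the `v_i` and have sum at most `2`,
so one has trace at most `2/n`. Conjugating by a self-adjoint contraction that almost swaps `u` and
`v_i` does not raise the trace and moves the almost-fixed vector to `u`. A one-vector Kadison
transitivity theorem makes the fixing exact (`IsIrreducibleRep.exists_small_trace`), and induction
treats several vectors (`exists_annihilator_large_trace`).

Extremality gives both irreducibility for pure states and factoriality for `τ`: a self-adjoint `R`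
of mean zero in the relevant commutant would write the functional as the midpoint of two others.
Finiteness holds because the tracial vector is separating for the von Neumann algebra. -/

/-! ### Von Neumann's density theorem on finitely many vectors -/

section DoubleCommutant

variable {H : Type*} [NormedAddCommGroup H] [InnerProductSpace ℂ H] [CompleteSpace H]

/-- The diagonal action of a bounded operator on a finite power of `H`. -/
noncomputable def diagonalOperator {ι : Type*} [Fintype ι] (T : H →L[ℂ] H) :
    PiLp 2 (fun _ : ι => H) →L[ℂ] PiLp 2 (fun _ : ι => H) :=
  (PiLp.continuousLinearEquiv 2 ℂ (fun _ : ι => H)).symm.toContinuousLinearMap ∘L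
    (ContinuousLinearMap.pi fun i => T ∘L ContinuousLinearMap.proj i) ∘L
      (PiLp.continuousLinearEquiv 2 ℂ (fun _ : ι => H)).toContinuousLinearMap

omit [CompleteSpace H] in
@[simp]
theorem diagonalOperator_apply {ι : Type*} [Fintype ι] (T : H →L[ℂ] H)
    (u : PiLp 2 (fun _ : ι => H)) (i : ι) : diagonalOperator T u i = T (u i) := rfl

/-- A finite form of von Neumann's density theorem. -/
theorem StarSubalgebra.exists_approx_of_mem_bicommutant (S : StarSubalgebra ℂ (H →L[ℂ] H))
    {x : H →L[ℂ] H} (hx : x ∈ Set.centralizer (Set.centralizer (S : Set (H →L[ℂ] H))))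
    {ι : Type*} [Fintype ι] (v : ι → H) {ε : ℝ} (hε : 0 < ε) :
    ∃ a ∈ S, ∀ i, ‖a (v i) - x (v i)‖ < ε := by
  classical
  let w : PiLp 2 (fun _ : ι => H) := WithLp.toLp 2 v
  let V₀ : Submodule ℂ (PiLp 2 (fun _ : ι => H)) :=
    { carrier := {u | ∃ a ∈ S, u = diagonalOperator a w}
      zero_mem' := ⟨0, zero_mem _, by ext i; simp⟩
      add_mem' := by
        rintro _ _ ⟨a, ha, rfl⟩ ⟨b, hb, rfl⟩
        exact ⟨a + b, add_mem ha hb, by ext i; simp⟩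
      smul_mem' := by
        rintro c _ ⟨a, ha, rfl⟩
        exact ⟨c • a, S.smul_mem ha c, by ext i; simp⟩ }
  let V := V₀.topologicalClosure
  have hV : IsClosed (V : Set (PiLp 2 (fun _ : ι => H))) := V₀.isClosed_topologicalClosure
  have : CompleteSpace V := hV.completeSpace_coe
  have hinv : ∀ a ∈ S, ∀ u ∈ V, diagonalOperator a u ∈ V := by
    intro a ha u hu
    have hmaps : Set.MapsTo (diagonalOperator a) (V₀ : Set (PiLp 2 (fun _ : ι => H))) (V₀ : Set (PiLp 2 (fun _ : ι => H))) := by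
      rintro _ ⟨b, hb, rfl⟩
      exact ⟨a * b, mul_mem ha hb, by ext i; simp⟩
    exact hmaps.closure (diagonalOperator a).continuous hu
  -- `S` is closed under adjoints, so the orthogonal complement of `V` is invariant too and the
  -- projection commutes with the amplified action.
  have hcomm : ∀ a ∈ S, ∀ u : PiLp 2 (fun _ : ι => H),
      V.starProjection (diagonalOperator a u) = diagonalOperator a (V.starProjection u) := by
    intro a ha u
    refine Submodule.eq_starProjection_of_mem_of_inner_eq_zero
      (hinv a ha _ (Submodule.starProjection_apply_mem V u)) ?_
    intro z hz
    have h1 : inner ℂ (diagonalOperator a (u - V.starProjection u)) z =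
        inner ℂ (u - V.starProjection u) (diagonalOperator (star a) z) := by
      simp only [PiLp.inner_apply, diagonalOperator_apply, ContinuousLinearMap.star_eq_adjoint,
        ContinuousLinearMap.adjoint_inner_right]
    rw [← map_sub, h1]
    exact Submodule.starProjection_inner_eq_zero u _ (hinv _ (star_mem ha) z hz)
  let sgl : ι → H →L[ℂ] PiLp 2 (fun _ : ι => H) := fun j =>
    (PiLp.continuousLinearEquiv 2 ℂ (fun _ : ι => H)).symm.toContinuousLinearMap ∘L
      ContinuousLinearMap.single ℂ (fun _ : ι => H) j
  have hsgl : ∀ (T : H →L[ℂ] H) j y, diagonalOperator T (sgl j y) = sgl j (T y) := by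
    intro T j y
    ext i
    by_cases h : i = j
    · subst h; simp [sgl]
    · simp [sgl, h]
  have hsum : ∀ u : PiLp 2 (fun _ : ι => H), u = ∑ j, sgl j (u j) := by
    intro u
    ext i
    simp [sgl]
  have hxcomm : ∀ u : PiLp 2 (fun _ : ι => H),
      V.starProjection (diagonalOperator x u) = diagonalOperator x (V.starProjection u) := by
    have key : ∀ j y, V.starProjection (sgl j (x y)) =
        diagonalOperator x (V.starProjection (sgl j y)) := by
      intro j y
      ext i
      -- The matrix entries of the projection lie in the commutant of `S`, hence commute with `x`;
      -- so the amplification of `x` commutes with the projection.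
      let Pij : H →L[ℂ] H := (PiLp.proj 2 (fun _ : ι => H) i : PiLp 2 (fun _ : ι => H) →L[ℂ] H) ∘L
        V.starProjection ∘L sgl j
      have hP : Pij ∈ Set.centralizer (S : Set (H →L[ℂ] H)) := by
        intro a ha
        ext z
        have := congrArg (fun u : PiLp 2 (fun _ : ι => H) => u i) (hcomm a ha (sgl j z))
        simp only [hsgl, diagonalOperator_apply] at this
        exact this.symm
      have := congrArg (fun T : H →L[ℂ] H => T y) (hx Pij hP)
      exact this
    intro u
    conv_lhs => rw [hsum u]
    conv_rhs => rw [hsum u]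
    simp only [map_sum, hsgl, key]
  have hw : w ∈ V := V₀.le_topologicalClosure ⟨1, one_mem _, by ext i; simp⟩
  have hxw : diagonalOperator x w ∈ V := by
    have := hxcomm w
    rw [Submodule.starProjection_eq_self_iff.mpr hw] at this
    exact Submodule.starProjection_eq_self_iff.mp this
  obtain ⟨u, ⟨a, ha, rfl⟩, hu⟩ := Metric.mem_closure_iff.mp
    (show diagonalOperator x w ∈ closure (V₀ : Set (PiLp 2 (fun _ : ι => H))) from hxw) ε hε
  refine ⟨a, ha, fun i => ?_⟩
  rw [dist_comm, dist_eq_norm] at hu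
  exact (PiLp.norm_apply_le (diagonalOperator a w - diagonalOperator x w) i).trans_lt hu

end DoubleCommutant

/-! ### Density of self-adjoint elements in irreducible representations -/

section Irreducible

variable {A : Type*} [CStarAlgebra A] {H : Type*} [NormedAddCommGroup H] [InnerProductSpace ℂ H]
  [CompleteSpace H]

/-- A representation is irreducible if only the scalars commute with its range. -/
def IsIrreducibleRep (π : A →⋆ₐ[ℂ] (H →L[ℂ] H)) : Prop :=
  ∀ T : H →L[ℂ] H, (∀ a, π a * T = T * π a) → ∃ c : ℂ, T = c • 1

theorem IsIrreducibleRep.exists_approx {π : A →⋆ₐ[ℂ] (H →L[ℂ] H)} (hπ : IsIrreducibleRep π)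
    (x : H →L[ℂ] H) {ι : Type*} [Fintype ι] (v : ι → H) {ε : ℝ} (hε : 0 < ε) :
    ∃ a, ∀ i, ‖π a (v i) - x (v i)‖ < ε := by
  obtain ⟨_, ⟨a, rfl⟩, ha⟩ := π.range.exists_approx_of_mem_bicommutant (x := x) (by
    intro T hT
    obtain ⟨c, rfl⟩ := hπ T fun a => hT _ ⟨a, rfl⟩
    simp) v hε
  exact ⟨a, ha⟩

theorem inner_add_inner_eq_of_isSelfAdjoint {T : H →L[ℂ] H} (hT : IsSelfAdjoint T) (u v : H) :
    inner ℂ u (T v) + inner ℂ v (T u) = ((2 * (inner ℂ u (T v)).re : ℝ) : ℂ) := by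
  have : inner ℂ v (T u) = starRingEnd ℂ (inner ℂ u (T v)) := by
    rw [inner_conj_symm]
    conv_lhs => rw [← hT.star_eq, ContinuousLinearMap.star_eq_adjoint,
      ContinuousLinearMap.adjoint_inner_right]
  rw [this, Complex.add_conj]

/-- In an irreducible representation, a self-adjoint operator can be approximated on finitely many
vectors by self-adjoint elements of the algebra. -/
theorem IsIrreducibleRep.exists_isSelfAdjoint_approx {π : A →⋆ₐ[ℂ] (H →L[ℂ] H)}
    (hπ : IsIrreducibleRep π) {x : H →L[ℂ] H} (hx : IsSelfAdjoint x)
    {ι : Type*} [Fintype ι] (v : ι → H) {ε : ℝ} (hε : 0 < ε) :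
    ∃ a, IsSelfAdjoint a ∧ ∀ i, ‖π a (v i) - x (v i)‖ < ε := by
  classical
  let W : Set (ι → H) := {w | ∃ a : A, IsSelfAdjoint a ∧ w = fun i => π a (v i)}
  suffices h : (fun i => x (v i)) ∈ closure W by
    obtain ⟨_, ⟨a, ha, rfl⟩, hw⟩ := Metric.mem_closure_iff.mp h ε hε
    refine ⟨a, ha, fun i => ?_⟩
    rw [dist_comm, dist_eq_norm] at hw
    exact (norm_le_pi_norm (fun i => π a (v i) - x (v i)) i).trans_lt hw
  by_contra hnot
  have hconv : Convex ℝ W := by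
    rintro _ ⟨a, ha, rfl⟩ _ ⟨b, hb, rfl⟩ s t _ _ _
    refine ⟨s • a + t • b, (IsSelfAdjoint.smul (.all s) ha).add (IsSelfAdjoint.smul (.all t) hb), ?_⟩
    ext i
    have h1 : ∀ (s : ℝ) (a : A), π (s • a) = s • π a := fun s a => by
      rw [← Complex.coe_smul, map_smul, Complex.coe_smul]
    simp [h1]
  -- Adjoints are not strongly continuous, so real parts of approximants need not approximate;
  -- convex separation is used instead.
  obtain ⟨f, u, hfW, hfx⟩ := RCLike.geometric_hahn_banach_closed_point (𝕜 := ℂ)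
    hconv.closure isClosed_closure hnot
  let μ : ι → H := fun i => (InnerProductSpace.toDual ℂ H).symm
    (f ∘L ContinuousLinearMap.single ℂ (fun _ : ι => H) i)
  have hf : ∀ w, f w = ∑ i, inner ℂ (μ i) (w i) := by
    intro w
    simp only [μ, InnerProductSpace.toDual_symm_apply]
    conv_lhs => rw [← Finset.univ_sum_single w]
    simp
  -- `W` is a real subspace, so a real functional bounded above on it vanishes there; rescaling by
  -- `u / r` would attain the bound `u`.
  have hzero : ∀ a : A, IsSelfAdjoint a → (f fun i => π a (v i)).re = 0 := by
    intro a ha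
    by_contra hne
    have h0 : 0 < u := by
      have := hfW _ (subset_closure ⟨0, .zero A, rfl⟩)
      simp only [map_zero, zero_apply] at this
      rwa [show (fun _ : ι => (0 : H)) = 0 from rfl, map_zero, map_zero] at this
    set r := (f fun i => π a (v i)).re
    have := hfW _ (subset_closure ⟨((u / r : ℝ)) • a, IsSelfAdjoint.smul (.all _) ha, rfl⟩)
    rw [show (fun i => π ((u / r : ℝ) • a) (v i)) = ((u / r : ℝ) : ℂ) • fun i => π a (v i) by
      ext i; rw [← Complex.coe_smul, map_smul]; rfl, map_smul] at this
    simp only [smul_eq_mul, RCLike.re_to_complex, Complex.re_ofReal_mul] at this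
    change u / r * r < u at this
    rw [div_mul_cancel₀ _ hne] at this
    exact lt_irrefl _ this
  -- This symmetrization is complex linear and equals `2 Re f` on self-adjoint operators. Hence it
  -- vanishes on all of `π(A)`, and, seeing only the vectors `v` and `μ`, also at `x` by density.
  let g : (H →L[ℂ] H) → ℂ := fun T => ∑ i, (inner ℂ (μ i) (T (v i)) + inner ℂ (v i) (T (μ i)))
  have hg : ∀ T, IsSelfAdjoint T → g T = ((2 * (f fun i => T (v i)).re : ℝ) : ℂ) := by
    intro T hT
    simp only [g, inner_add_inner_eq_of_isSelfAdjoint hT, hf, Complex.re_sum, Finset.mul_sum,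
      Complex.ofReal_sum]
  have hgadd : ∀ S T, g (S + T) = g S + g T := by
    intro S T
    simp only [g, add_apply, inner_add_right, ← Finset.sum_add_distrib]
    exact Finset.sum_congr rfl fun i _ => by ring
  have hgsmul : ∀ (c : ℂ) T, g (c • T) = c * g T := by
    intro c T
    simp only [g, smul_apply, inner_smul_right, Finset.mul_sum]
    exact Finset.sum_congr rfl fun i _ => by ring
  have hga : ∀ a, g (π a) = 0 := by
    intro a
    have hsa : ∀ b, IsSelfAdjoint b → g (π b) = 0 := fun b hb => by
      rw [hg _ (hb.map π), hzero b hb]; simp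
    rw [← realPart_add_I_smul_imaginaryPart a, map_add, map_smul, hgadd, hgsmul,
      hsa _ (realPart a).2, hsa _ (imaginaryPart a).2]
    simp
  have hgx : g x = 0 := by
    by_contra hne
    set C : ℝ := ∑ i, (‖μ i‖ + ‖v i‖)
    have hC : 0 ≤ C := Finset.sum_nonneg fun i _ => by positivity
    have hpos : 0 < ‖g x‖ := norm_pos_iff.mpr hne
    obtain ⟨a, ha⟩ := hπ.exists_approx x (Sum.elim v μ)
      (ε := ‖g x‖ / (C + 1)) (by positivity)
    have h1 : g x = - g (π a - x) := by
      rw [sub_eq_add_neg, hgadd, hga, ← neg_one_smul ℂ x, hgsmul]; ring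
    have h2 : ‖g (π a - x)‖ ≤ C * (‖g x‖ / (C + 1)) := by
      rw [Finset.sum_mul]
      refine (norm_sum_le _ _).trans (Finset.sum_le_sum fun i _ => ?_)
      refine (norm_add_le _ _).trans ?_
      rw [add_mul]
      exact add_le_add
        ((norm_inner_le_norm _ _).trans
          (mul_le_mul_of_nonneg_left (ha (.inl i)).le (norm_nonneg _)))
        ((norm_inner_le_norm _ _).trans
          (mul_le_mul_of_nonneg_left (ha (.inr i)).le (norm_nonneg _)))
    rw [← norm_neg, ← h1, mul_div_assoc', le_div_iff₀ (by positivity)] at h2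
    nlinarith
  have h0 : 0 < u := by
    have := hfW _ (subset_closure ⟨0, .zero A, rfl⟩)
    simp only [map_zero, zero_apply] at this
    rwa [show (fun _ : ι => (0 : H)) = 0 from rfl, map_zero, map_zero] at this
  rw [hg x hx] at hgx
  have hre : (f fun i => x (v i)).re = 0 := by
    have := Complex.ofReal_eq_zero.mp hgx
    linarith
  exact absurd (hfx.trans_eq hre) h0.le.not_gt

end Irreducible

/-! ### The bounded transform as a substitute for Kaplansky density -/

section RationalTransform

variable {A : Type*} [CStarAlgebra A]

/-- The resolvent-like element `(1 + a²)⁻¹`. -/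
noncomputable def invOneAddSq (a : A) : A := cfc (fun t : ℝ => 1 / (1 + t ^ 2)) a

/-- The bounded transform `2 a (1 + a²)⁻¹`. -/
noncomputable def boundedTransform (a : A) : A := cfc (fun t : ℝ => 2 * t / (1 + t ^ 2)) a

theorem continuous_one_div_one_add_sq : Continuous fun t : ℝ => 1 / (1 + t ^ 2) :=
  continuous_const.div (by fun_prop) fun t => by positivity

theorem continuous_two_mul_div_one_add_sq : Continuous fun t : ℝ => 2 * t / (1 + t ^ 2) :=
  Continuous.div (by fun_prop) (by fun_prop) fun t => by positivity

theorem isSelfAdjoint_boundedTransform (a : A) : IsSelfAdjoint (boundedTransform a) :=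
  cfc_predicate _ a

theorem norm_invOneAddSq_le (a : A) : ‖invOneAddSq a‖ ≤ 1 := by
  refine norm_cfc_le zero_le_one fun t _ => ?_
  rw [Real.norm_eq_abs, abs_of_nonneg (by positivity), div_le_one (by positivity)]
  nlinarith [sq_nonneg t]

theorem norm_boundedTransform_le (a : A) : ‖boundedTransform a‖ ≤ 1 := by
  refine norm_cfc_le zero_le_one fun t _ => ?_
  rw [Real.norm_eq_abs, abs_div, abs_of_nonneg (a := 1 + t ^ 2) (by positivity),
    div_le_one (by positivity), abs_le]
  constructor <;> nlinarith [sq_nonneg (t - 1), sq_nonneg (t + 1)]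

theorem boundedTransform_eq_mul {a : A} (ha : IsSelfAdjoint a) :
    boundedTransform a = (2 : ℂ) • (invOneAddSq a * a) := by
  have h1 : a = cfc (fun t : ℝ => t) a := (cfc_id' ℝ a).symm
  have h2 : invOneAddSq a * a = cfc (fun t : ℝ => 1 / (1 + t ^ 2) * t) a := by
    conv_lhs => rw [invOneAddSq]; arg 2; rw [h1]
    rw [← cfc_mul _ _ a continuous_one_div_one_add_sq.continuousOn continuous_id'.continuousOn]
  rw [h2, show (2 : ℂ) = ((2 : ℝ) : ℂ) by norm_num, Complex.coe_smul, boundedTransform,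
    ← cfc_smul _ _ a (by
      exact (continuous_one_div_one_add_sq.mul continuous_id').continuousOn)]
  refine cfc_congr fun t _ => ?_
  simp only [smul_eq_mul]
  ring

theorem invOneAddSq_mul {a : A} (ha : IsSelfAdjoint a) : invOneAddSq a * (1 + a ^ 2) = 1 := by
  have h1 : (1 + a ^ 2 : A) = cfc (fun t : ℝ => 1 + t ^ 2) a := by
    rw [cfc_const_add (1 : ℝ) (fun t : ℝ => t ^ 2) a, cfc_pow_id (R := ℝ) a 2, map_one]
  rw [h1, invOneAddSq, ← cfc_mul _ _ a continuous_one_div_one_add_sq.continuousOn (by fun_prop),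
    ← cfc_one ℝ a]
  refine cfc_congr fun t _ => ?_
  have : (1 + t ^ 2) ≠ 0 := by positivity
  simp [this]

/-- Pointwise, `(1 + t²)² ≥ 1`. This keeps the trace under control when a self-adjoint element is
cut down to a contraction. -/
theorem boundedTransform_sq_le [PartialOrder A] [StarOrderedRing A] {a : A}
    (ha : IsSelfAdjoint a) : boundedTransform a ^ 2 ≤ (4 : ℝ) • a ^ 2 := by
  have h1 : (4 : ℝ) • a ^ 2 = cfc (fun t : ℝ => (4 : ℝ) • t ^ 2) a := by
    rw [cfc_smul (4 : ℝ) (fun t : ℝ => t ^ 2) a, cfc_pow_id (R := ℝ) a 2]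
  have hc := continuous_two_mul_div_one_add_sq
  rw [h1, boundedTransform, ← cfc_pow _ 2 a hc.continuousOn]
  refine cfc_mono (fun t _ => ?_) (hc.pow 2).continuousOn (by fun_prop)
  rw [div_pow, smul_eq_mul, div_le_iff₀ (by positivity)]
  nlinarith [sq_nonneg t, sq_nonneg (t ^ 2), mul_nonneg (sq_nonneg t) (sq_nonneg (t ^ 2))]

variable {H : Type*} [NormedAddCommGroup H] [InnerProductSpace ℂ H] [CompleteSpace H]

theorem StarAlgHom.norm_apply_apply_le (π : A →⋆ₐ[ℂ] (H →L[ℂ] H)) (a : A) (v : H) :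
    ‖π a v‖ ≤ ‖a‖ * ‖v‖ :=
  ((π a).le_opNorm v).trans
    (mul_le_mul_of_nonneg_right (NonUnitalStarAlgHom.norm_apply_le π a) (norm_nonneg v))

theorem invOneAddSq_mul_mul_self {a : A} (ha : IsSelfAdjoint a) :
    invOneAddSq a * (a * a) = 1 - invOneAddSq a := by
  have h := invOneAddSq_mul ha
  rw [mul_add, mul_one, sq] at h
  rw [← h]; abel

theorem norm_invOneAddSq_mul_le {a : A} (ha : IsSelfAdjoint a) : ‖invOneAddSq a * a‖ ≤ 1 := by
  have h := norm_boundedTransform_le a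
  rw [boundedTransform_eq_mul ha, norm_smul] at h
  norm_num at h
  linarith [norm_nonneg (invOneAddSq a * a)]

/-- If `a` almost exchanges two vectors, so does its bounded transform. -/
theorem norm_boundedTransform_apply_sub_le (π : A →⋆ₐ[ℂ] (H →L[ℂ] H)) {a : A}
    (ha : IsSelfAdjoint a) (u v : H) :
    ‖π (boundedTransform a) u - v‖ ≤ ‖π a u - v‖ + ‖π a v - u‖ := by
  -- With `R = (1 + a²)⁻¹`, expand using `R a² = 1 - R`; the factors `R` and `R a` are contractions.
  have key : π (boundedTransform a) u - v =
      π (invOneAddSq a) (π a u - v) - π (invOneAddSq a * a) (π a v - u) := by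
    have h : π (invOneAddSq a * a) (π a v) = v - π (invOneAddSq a) v := by
      have := congrArg (fun b => π b v) (invOneAddSq_mul_mul_self ha)
      simpa [mul_assoc] using this
    rw [map_sub, map_sub, h, boundedTransform_eq_mul ha, map_smul, smul_apply, two_smul]
    simp only [map_mul, mul_apply_eq_comp]
    abel
  rw [key]
  refine (norm_sub_le _ _).trans (add_le_add ?_ ?_)
  · refine (π.norm_apply_apply_le _ _).trans ?_
    exact mul_le_of_le_one_left (norm_nonneg _) (norm_invOneAddSq_le a)
  · refine (π.norm_apply_apply_le _ _).trans ?_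
    exact mul_le_of_le_one_left (norm_nonneg _) (norm_invOneAddSq_mul_le ha)

end RationalTransform

/-! ### Kadison transitivity for one vector -/

section Transitivity

variable {A : Type*} [CStarAlgebra A] {H : Type*} [NormedAddCommGroup H] [InnerProductSpace ℂ H]
  [CompleteSpace H]

theorem exists_isSelfAdjoint_swap {u v : H} (hu : ‖u‖ = 1) (hv : ‖v‖ = 1) (huv : inner ℂ u v = 0) :
    ∃ x : H →L[ℂ] H, IsSelfAdjoint x ∧ x u = v ∧ x v = u := by
  refine ⟨InnerProductSpace.rankOne ℂ v u + InnerProductSpace.rankOne ℂ u v, ?_, ?_, ?_⟩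
  · rw [IsSelfAdjoint, star_add, ContinuousLinearMap.star_eq_adjoint,
      ContinuousLinearMap.star_eq_adjoint, InnerProductSpace.adjoint_rankOne,
      InnerProductSpace.adjoint_rankOne, add_comm]
  · have : inner ℂ v u = 0 := inner_eq_zero_symm.mp huv
    simp [InnerProductSpace.rankOne_apply, this, inner_self_eq_norm_sq_to_K, hu]
  · simp [InnerProductSpace.rankOne_apply, huv, inner_self_eq_norm_sq_to_K, hv]

/-- Two orthogonal unit vectors are almost exchanged by a self-adjoint contraction. -/
theorem IsIrreducibleRep.exists_contraction_swap {π : A →⋆ₐ[ℂ] (H →L[ℂ] H)}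
    (hπ : IsIrreducibleRep π) {u v : H} (hu : ‖u‖ = 1) (hv : ‖v‖ = 1) (huv : inner ℂ u v = 0)
    {ε : ℝ} (hε : 0 < ε) :
    ∃ b : A, IsSelfAdjoint b ∧ ‖b‖ ≤ 1 ∧ ‖π b u - v‖ < ε ∧ ‖π b v - u‖ < ε := by
  obtain ⟨x, hx, hxu, hxv⟩ := exists_isSelfAdjoint_swap hu hv huv
  obtain ⟨a, ha, hav⟩ := hπ.exists_isSelfAdjoint_approx hx ![u, v] (half_pos hε)
  have h1 := hav 0
  have h2 := hav 1
  simp only [Matrix.cons_val_zero, Matrix.cons_val_one, hxu, hxv] at h1 h2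
  exact ⟨boundedTransform a, isSelfAdjoint_boundedTransform a, norm_boundedTransform_le a,
    (norm_boundedTransform_apply_sub_le π ha u v).trans_lt (by linarith),
    (norm_boundedTransform_apply_sub_le π ha v u).trans_lt (by linarith)⟩

/-- Write `v = α u + w` with `w ⊥ u`; `α` is real by hypothesis, as it must be since `⟪u, k u⟫` is
real for self-adjoint `k`. Take `k = α + ‖w‖ b` with `b` almost swapping `u` and `w / ‖w‖`. As `‖w‖
≤ 2 ‖v‖`, the swap error `1/4` leaves at most `‖v‖ / 2`. -/
theorem IsIrreducibleRep.exists_isSelfAdjoint_half {π : A →⋆ₐ[ℂ] (H →L[ℂ] H)}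
    (hπ : IsIrreducibleRep π) {u : H} (hu : ‖u‖ = 1) {v : H} (hv : (inner ℂ u v).im = 0) :
    ∃ k : A, IsSelfAdjoint k ∧ ‖k‖ ≤ 3 * ‖v‖ ∧ ‖π k u - v‖ ≤ ‖v‖ / 2 := by
  have : Nontrivial H := ⟨u, 0, fun h => by simp [h] at hu⟩
  have : Nontrivial A := by
    by_contra h
    rw [not_nontrivial_iff_subsingleton] at h
    have h1 : π 1 u = π 0 u := by rw [Subsingleton.elim (1 : A) 0]
    simp only [map_one, map_zero, one_apply_eq_self, zero_apply] at h1
    simp [h1] at hu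
  set α : ℝ := (inner ℂ u v).re with hα
  have hαc : inner ℂ u v = (α : ℂ) := Complex.ext rfl (by simp [hv])
  have hαle : |α| ≤ ‖v‖ := by
    have h := norm_inner_le_norm (𝕜 := ℂ) u v
    rwa [hαc, hu, one_mul, Complex.norm_real, Real.norm_eq_abs] at h
  have hsmul : ∀ (r : ℝ) (a : A) w, π (r • a) w = (r : ℂ) • π a w := fun r a w => by
    rw [← Complex.coe_smul, map_smul, smul_apply]
  set w := v - (α : ℂ) • u with hw
  have huw : inner ℂ u w = 0 := by
    rw [hw, inner_sub_right, inner_smul_right, inner_self_eq_norm_sq_to_K, hu, hαc]; simp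
  have hwle : ‖w‖ ≤ 2 * ‖v‖ := by
    refine (norm_sub_le _ _).trans ?_
    rw [norm_smul, hu, Complex.norm_real, Real.norm_eq_abs]
    linarith
  have hone : ‖α • (1 : A)‖ ≤ ‖v‖ := by
    rw [norm_smul, CStarRing.norm_one, mul_one]; exact hαle
  by_cases hw0 : w = 0
  · refine ⟨α • 1, IsSelfAdjoint.smul (.all _) (.one A), hone.trans ?_, ?_⟩
    · linarith [norm_nonneg v]
    · rw [hsmul, map_one, one_apply_eq_self, norm_sub_rev, ← hw, hw0, norm_zero]
      positivity
  · have hwpos : 0 < ‖w‖ := norm_pos_iff.mpr hw0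
    obtain ⟨b, hb, hb1, hbu, -⟩ := hπ.exists_contraction_swap hu
      (v := ((‖w‖⁻¹ : ℝ) : ℂ) • w)
      (by rw [norm_smul, Complex.norm_real, norm_inv, norm_norm, inv_mul_cancel₀ hwpos.ne'])
      (by rw [inner_smul_right, huw, mul_zero]) (ε := 1 / 4) (by norm_num)
    refine ⟨α • 1 + ‖w‖ • b, (IsSelfAdjoint.smul (.all _) (.one A)).add
      (IsSelfAdjoint.smul (.all _) hb), ?_, ?_⟩
    · refine (norm_add_le _ _).trans ?_
      have : ‖‖w‖ • b‖ ≤ 2 * ‖v‖ := by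
        rw [norm_smul, norm_norm]
        exact (mul_le_of_le_one_right (norm_nonneg _) hb1).trans hwle
      linarith
    · have : π (α • 1 + ‖w‖ • b) u - v = (‖w‖ : ℂ) • (π b u - ((‖w‖⁻¹ : ℝ) : ℂ) • w) := by
        rw [map_add, add_apply, hsmul, hsmul, map_one, one_apply_eq_self, smul_sub,
          smul_smul, ← Complex.ofReal_mul, mul_inv_cancel₀ hwpos.ne', Complex.ofReal_one, one_smul,
          hw]
        abel
      rw [this, norm_smul, Complex.norm_real, norm_norm]
      nlinarith [norm_nonneg (π b u - ((‖w‖⁻¹ : ℝ) : ℂ) • w)]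

theorem im_inner_apply_self_of_isSelfAdjoint {T : H →L[ℂ] H} (hT : IsSelfAdjoint T) (u : H) :
    (inner ℂ u (T u)).im = 0 := by
  have h := congrArg Complex.im (inner_add_inner_eq_of_isSelfAdjoint hT u u)
  rw [Complex.add_im, Complex.ofReal_im] at h
  linarith

/-- Transitivity of irreducible representations on one vector, for self-adjoint elements. -/
theorem IsIrreducibleRep.exists_isSelfAdjoint_apply_eq {π : A →⋆ₐ[ℂ] (H →L[ℂ] H)}
    (hπ : IsIrreducibleRep π) {u : H} (hu : ‖u‖ = 1) {v : H} (hv : (inner ℂ u v).im = 0) :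
    ∃ k : A, IsSelfAdjoint k ∧ ‖k‖ ≤ 6 * ‖v‖ ∧ π k u = v := by
  choose! k hk hkn hkv using fun (v : H) (hv : (inner ℂ u v).im = 0) =>
    hπ.exists_isSelfAdjoint_half hu hv
  -- Successive residuals: each at least halves in norm and keeps a real inner product with `u`, so
  -- the corrections sum geometrically, to norm at most `3 ‖v‖ * 2`.
  let r : ℕ → H := fun n => n.rec v fun _ w => w - π (k w) u
  have hr0 : r 0 = v := rfl
  have hrs : ∀ n, r (n + 1) = r n - π (k (r n)) u := fun n => rfl
  have him : ∀ n, (inner ℂ u (r n)).im = 0 := by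
    intro n
    induction n with
    | zero => exact hv
    | succ n ih =>
      rw [hrs, inner_sub_right, Complex.sub_im, ih,
        im_inner_apply_self_of_isSelfAdjoint ((hk _ ih).map π), sub_zero]
  have hnorm : ∀ n, ‖r n‖ ≤ ‖v‖ * (1 / 2) ^ n := by
    intro n
    induction n with
    | zero => simp [hr0]
    | succ n ih =>
      rw [hrs, norm_sub_rev, pow_succ]
      linarith [hkv _ (him n)]
  have hkle : ∀ n, ‖k (r n)‖ ≤ 3 * ‖v‖ * (1 / 2) ^ n := fun n =>
    (hkn _ (him n)).trans (by linarith [hnorm n])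
  have hgeom : HasSum (fun n : ℕ => 3 * ‖v‖ * (1 / 2 : ℝ) ^ n) (3 * ‖v‖ * 2) :=
    hasSum_geometric_two.mul_left _
  have hsummable : Summable fun n => k (r n) := .of_norm_bounded hgeom.summable hkle
  refine ⟨∑' n, k (r n), ?_, ?_, ?_⟩
  · rw [IsSelfAdjoint, tsum_star]
    exact tsum_congr fun n => (hk _ (him n)).star_eq
  · exact (tsum_of_norm_bounded hgeom hkle).trans_eq (by ring)
  · have hpart : ∀ n, π (∑ i ∈ Finset.range n, k (r i)) u = v - r n := by
      intro n
      induction n with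
      | zero => simp [hr0]
      | succ n ih =>
        rw [Finset.sum_range_succ, map_add, add_apply, ih, hrs]
        abel
    have hcont : Continuous fun a => π a u :=
      (AddMonoidHomClass.continuous_of_bound π 1 fun a => by
        rw [one_mul]; exact NonUnitalStarAlgHom.norm_apply_le π a).clm_apply continuous_const
    have h1 := (hcont.tendsto _).comp hsummable.hasSum.tendsto_sum_nat
    have h2 : Filter.Tendsto r Filter.atTop (nhds 0) := by
      refine squeeze_zero_norm hnorm ?_
      simpa using (tendsto_pow_atTop_nhds_zero_of_lt_one (by norm_num : (0 : ℝ) ≤ 1 / 2)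
        (by norm_num)).const_mul ‖v‖
    have h3 : Filter.Tendsto (fun n => v - r n) Filter.atTop (nhds v) := by
      simpa using h2.const_sub v
    refine tendsto_nhds_unique h1 (h3.congr fun n => ?_)
    exact (hpart n).symm

end Transitivity

/-! ### Contractions of small trace fixing a vector -/

section Trace

variable {A : Type*} [CStarAlgebra A] [PartialOrder A] [StarOrderedRing A]

theorem mul_self_le_one_of_norm_le_one {k : A} (hk : IsSelfAdjoint k) (hk1 : ‖k‖ ≤ 1) :
    k * k ≤ 1 := by
  rw [← CStarAlgebra.norm_le_one_iff_of_nonneg _ hk.mul_self_nonneg]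
  exact (norm_mul_le _ _).trans (mul_le_one₀ hk1 (norm_nonneg _) hk1)

omit [StarOrderedRing A] in
theorem re_map_mono (τ : A →ₚ[ℂ] ℂ) {a b : A} (h : a ≤ b) : (τ a).re ≤ (τ b).re :=
  (Complex.le_def.mp (OrderHomClass.mono τ h)).1

omit [StarOrderedRing A] in
theorem re_map_nonneg (τ : A →ₚ[ℂ] ℂ) {a : A} (h : 0 ≤ a) : 0 ≤ (τ a).re := by
  simpa using re_map_mono τ h

omit [StarOrderedRing A] in
theorem re_map_real_smul (τ : A →ₚ[ℂ] ℂ) (r : ℝ) (a : A) : (τ (r • a)).re = r * (τ a).re := by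
  rw [← Complex.coe_smul, map_smul, smul_eq_mul, Complex.re_ofReal_mul]

variable {τ : A →ₚ[ℂ] ℂ}

/-- With `r = √g`, the trace property turns `k g k` into `r k² r`, and `k² ≤ 1`. -/
theorem re_trace_conj_le (hτ : τ.toLinearMap ∈ traceSpace A) {k g : A} (hk : IsSelfAdjoint k)
    (hk1 : ‖k‖ ≤ 1) (hg : 0 ≤ g) : (τ (k * g * k)).re ≤ (τ g).re := by
  set r := CFC.sqrt g
  have hr : IsSelfAdjoint r := (CFC.sqrt_nonneg g).isSelfAdjoint
  have hrr : r * r = g := CFC.sqrt_mul_sqrt_self g hg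
  have h1 : τ (k * g * k) = τ (r * (k * k) * r) := by
    have := hτ.2 (k * r) (r * k)
    simp only [PositiveLinearMap.coe_toLinearMap] at this
    rw [← hrr]
    simpa only [mul_assoc] using this
  have h2 : r * (k * k) * r ≤ r * 1 * r := by
    have := star_left_conjugate_le_conjugate (mul_self_le_one_of_norm_le_one hk hk1) r
    rwa [hr.star_eq] at this
  rw [h1, ← hrr]
  simpa using re_map_mono τ h2

/-- At most one integer lies at distance less than `1/2` from `t`, contributing at most `1`. For the
others `4 n (t - i)² ≥ n`, so together they contribute at most `1`. -/
theorem sum_one_div_one_add_le (n : ℕ) (t : ℝ) :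
    ∑ i : Fin n, 1 / (1 + 4 * n * (t - i) ^ 2) ≤ 2 := by
  rcases Nat.eq_zero_or_pos n with rfl | hn
  · simp
  have hn' : (0 : ℝ) < n := by exact_mod_cast hn
  have h1 : ∀ i : Fin n, 1 / (1 + 4 * n * (t - i) ^ 2) ≤
      1 / (n : ℝ) + if |t - i| < 1 / 2 then 1 else 0 := by
    intro i
    split_ifs with h
    · have : 1 / (1 + 4 * n * (t - i) ^ 2) ≤ 1 := by
        rw [div_le_one (by positivity)]
        have : 0 ≤ 4 * n * (t - i) ^ 2 := by positivity
        linarith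
      have : (0 : ℝ) ≤ 1 / n := by positivity
      linarith
    · rw [add_zero]
      refine one_div_le_one_div_of_le hn' ?_
      have h2 : (1 / 2 : ℝ) ^ 2 ≤ (t - i) ^ 2 := by
        rw [← sq_abs (t - i)]
        exact pow_le_pow_left₀ (by norm_num) (not_lt.mp h) 2
      nlinarith
  refine (Finset.sum_le_sum fun i _ => h1 i).trans ?_
  rw [Finset.sum_add_distrib, Finset.sum_const, Finset.card_univ, Fintype.card_fin, nsmul_eq_mul,
    mul_one_div_cancel hn'.ne', Finset.sum_boole]
  have hcard : (Finset.univ.filter fun i : Fin n => |t - i| < 1 / 2).card ≤ 1 := by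
    rw [Finset.card_le_one]
    intro i hi j hj
    simp only [Finset.mem_filter, Finset.mem_univ, true_and, abs_lt] at hi hj
    have h3 : ((i : ℕ) : ℝ) < (j : ℕ) + 1 := by linarith [hi.1, hj.2]
    have h4 : ((j : ℕ) : ℝ) < (i : ℕ) + 1 := by linarith [hi.2, hj.1]
    have h5 : (i : ℕ) < j + 1 := by exact_mod_cast h3
    have h6 : (j : ℕ) < i + 1 := by exact_mod_cast h4
    exact Fin.ext (by omega)
  have : ((Finset.univ.filter fun i : Fin n => |t - i| < 1 / 2).card : ℝ) ≤ 1 := by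
    exact_mod_cast hcard
  linarith

theorem continuous_bump (n : ℕ) (s : ℝ) : Continuous fun t : ℝ => 1 / (1 + 4 * n * (t - s) ^ 2) :=
  continuous_const.div (by fun_prop) fun t => by positivity

variable {H : Type*} [NormedAddCommGroup H] [InnerProductSpace ℂ H] [CompleteSpace H]

/-- The bump minus `1` factors as `q (t) * (t - s)` with `|q| ≤ 4 n + 1`, so an approximate
eigenvector of `a` for `s` is almost fixed by the bump of `a`. -/
theorem norm_bump_apply_sub_le (π : A →⋆ₐ[ℂ] (H →L[ℂ] H)) {a : A} (ha : IsSelfAdjoint a) (n : ℕ)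
    (s : ℝ) (u : H) :
    ‖π (cfc (fun t : ℝ => 1 / (1 + 4 * n * (t - s) ^ 2)) a) u - u‖ ≤
      (4 * n + 1) * ‖π a u - (s : ℂ) • u‖ := by
  set f : ℝ → ℝ := fun t => 1 / (1 + 4 * n * (t - s) ^ 2)
  have hf : Continuous f := continuous_bump n s
  set q : ℝ → ℝ := fun t => - (4 * n * (t - s)) * f t
  have hq : Continuous q := (by fun_prop : Continuous fun t : ℝ => -(4 * n * (t - s))).mul hf
  have h1 : cfc f a - 1 = cfc q a * (a - algebraMap ℝ A s) := by
    have e1 : a - algebraMap ℝ A s = cfc (fun t : ℝ => t - s) a := by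
      rw [cfc_sub (fun t : ℝ => t) (fun _ => s) a, cfc_id' ℝ a, cfc_const s a]
    rw [e1, ← cfc_mul _ _ a hq.continuousOn (by fun_prop), ← cfc_one ℝ a,
      ← cfc_sub _ _ a hf.continuousOn (by fun_prop)]
    refine cfc_congr fun t _ => ?_
    have : 1 + 4 * n * (t - s) ^ 2 ≠ 0 := by positivity
    simp only [q, f, Pi.one_apply]
    field_simp
    ring
  have h2 : ‖cfc q a‖ ≤ 4 * n + 1 := by
    refine norm_cfc_le (by positivity) fun t _ => ?_
    have hp : 0 < 1 + 4 * n * (t - s) ^ 2 := by positivity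
    have hn : (0 : ℝ) ≤ n := Nat.cast_nonneg n
    rw [Real.norm_eq_abs]
    simp only [q, f]
    rw [mul_one_div, abs_div, abs_of_pos hp, div_le_iff₀ hp, abs_neg, abs_mul,
      abs_of_nonneg (a := 4 * (n : ℝ)) (by positivity), ← sq_abs (t - s)]
    nlinarith [mul_nonneg hn (sq_nonneg (|t - s| - 1)), mul_nonneg hn (sq_nonneg |t - s|),
      mul_nonneg (mul_nonneg hn hn) (sq_nonneg (|t - s|)),
      mul_nonneg (mul_nonneg hn hn) (sq_nonneg (2 * |t - s| - 1)), sq_nonneg (|t - s|)]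
  have h3 : π (cfc f a) u - u = π (cfc q a) (π a u - (s : ℂ) • u) := by
    have := congrArg (fun b => π b u) h1
    simpa [Algebra.algebraMap_eq_smul_one, ← Complex.coe_smul] using this
  rw [h3]
  exact (π.norm_apply_apply_le _ _).trans (mul_le_mul_of_nonneg_right h2 (norm_nonneg _))

theorem exists_orthonormal_nat {u : H} (hu : ‖u‖ = 1) (hH : ¬ FiniteDimensional ℂ H) :
    ∃ v : ℕ → H, Orthonormal ℂ v ∧ ∀ i, inner ℂ u (v i) = 0 := by
  have hs : Orthonormal ℂ ((↑) : ({u} : Set H) → H) := by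
    refine ⟨fun i => by rw [Set.mem_singleton_iff.mp i.2, hu], fun i j hij => ?_⟩
    exact absurd (Subsingleton.elim i j) hij
  obtain ⟨w, b, hw, hb⟩ := hs.exists_hilbertBasis_extension
  have hbo : Orthonormal ℂ ((↑) : w → H) := hb ▸ b.orthonormal
  have hinf : w.Infinite := by
    intro hfin
    have : Fintype w := hfin.fintype
    exact hH (b.toOrthonormalBasis.toBasis.finiteDimensional_of_finite)
  have hinf' : (w \ {u}).Infinite := hinf.sdiff (Set.finite_singleton u)
  let e := hinf'.natEmbedding
  refine ⟨fun i => e i, ?_, fun i => ?_⟩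
  · exact hbo.comp (fun i : ℕ => (⟨e i, (e i).2.1⟩ : w)) fun i j hij =>
      e.injective (Subtype.ext (congrArg (fun z : w => (z : H)) hij))
  · have hne : (⟨u, hw rfl⟩ : w) ≠ ⟨e i, (e i).2.1⟩ := fun h =>
      (e i).2.2 (congrArg (fun z : w => (z : H)) h).symm
    exact hbo.2 hne

theorem exists_isSelfAdjoint_diagonal {v : ℕ → H} (hv : Orthonormal ℂ v) (n : ℕ) :
    ∃ x : H →L[ℂ] H, IsSelfAdjoint x ∧ ∀ i < n, x (v i) = (i : ℂ) • v i := by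
  refine ⟨∑ i ∈ Finset.range n, (i : ℂ) • InnerProductSpace.rankOne ℂ (v i) (v i), ?_, ?_⟩
  · rw [IsSelfAdjoint, star_sum]
    refine Finset.sum_congr rfl fun i _ => ?_
    rw [star_smul, ContinuousLinearMap.star_eq_adjoint, InnerProductSpace.adjoint_rankOne]
    simp
  · intro i hi
    rw [sum_apply, Finset.sum_eq_single i]
    · simp [InnerProductSpace.rankOne_apply, inner_self_eq_norm_sq_to_K, hv.1 i]
    · intro j _ hj
      simp [InnerProductSpace.rankOne_apply, hv.2 hj]
    · intro h
      exact absurd (Finset.mem_range.mpr hi) h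

/-- A positive contraction of small trace that almost fixes a given vector. -/
theorem IsIrreducibleRep.exists_small_trace_approx (hτ : τ.toLinearMap ∈ traceSpace A)
    {π : A →⋆ₐ[ℂ] (H →L[ℂ] H)} (hπ : IsIrreducibleRep π) (hH : ¬ FiniteDimensional ℂ H)
    {u : H} (hu : ‖u‖ = 1) {ε δ : ℝ} (hε : 0 < ε) (hδ : 0 < δ) :
    ∃ h : A, 0 ≤ h ∧ h ≤ 1 ∧ (τ h).re < ε ∧ ‖π h u - u‖ < δ := by
  obtain ⟨v, hv, huv⟩ := exists_orthonormal_nat hu hH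
  -- The `n` bumps have total trace at most `2 < n * ε`, so one of them has trace below `ε`.
  obtain ⟨n, hn⟩ := exists_nat_gt (2 / ε)
  have hn0 : (0 : ℝ) < n := (by positivity : (0 : ℝ) < 2 / ε).trans hn
  obtain ⟨x, hx, hxv⟩ := exists_isSelfAdjoint_diagonal hv n
  obtain ⟨a, ha, hav⟩ := hπ.exists_isSelfAdjoint_approx hx (fun i : Fin n => v i)
    (ε := δ / 3 / (4 * n + 1)) (by positivity)
  let g : Fin n → A := fun i => cfc (fun t : ℝ => 1 / (1 + 4 * n * (t - (i : ℕ)) ^ 2)) a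
  have hg0 : ∀ i, 0 ≤ g i := fun i => cfc_nonneg fun t _ => by positivity
  have hgsum : ∑ i, g i ≤ (2 : ℝ) • (1 : A) := by
    rw [← cfc_sum_univ (fun (i : Fin n) (t : ℝ) => 1 / (1 + 4 * n * (t - (i : ℕ)) ^ 2)) a (fun i => (continuous_bump n (i : ℕ)).continuousOn),
      ← Algebra.algebraMap_eq_smul_one, ← cfc_const (2 : ℝ) a]
    refine cfc_mono (fun t _ => ?_)
      (by rw [Finset.sum_fn]
          exact (continuous_finsetSum _ fun i _ => continuous_bump n _).continuousOn) (by fun_prop)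
    simpa using sum_one_div_one_add_le n t
  have hg1 : ∀ i, g i ≤ 1 := fun i => by
    refine cfc_le_one _ _ fun t _ => ?_
    rw [div_le_one (by positivity)]
    have : 0 ≤ 4 * n * (t - (i : ℕ)) ^ 2 := by positivity
    linarith
  obtain ⟨i, hi⟩ : ∃ i, (τ (g i)).re < ε := by
    by_contra! hcon
    have h1 : ∑ i : Fin n, ε ≤ (τ (∑ i, g i)).re := by
      rw [map_sum, Complex.re_sum]
      exact Finset.sum_le_sum fun i _ => hcon i
    have h2 := re_map_mono τ hgsum
    have hone : τ 1 = 1 := hτ.1.2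
    rw [re_map_real_smul, hone, Complex.one_re] at h2
    rw [Finset.sum_const, Finset.card_univ, Fintype.card_fin, nsmul_eq_mul] at h1
    rw [div_lt_iff₀ hε] at hn
    linarith
  obtain ⟨k, hk, hk1, hku, hkv⟩ := hπ.exists_contraction_swap hu (hv.1 i) (huv i)
    (ε := δ / 3) (by positivity)
  have hgi : ‖π (g i) (v i) - v i‖ < δ / 3 := by
    refine (norm_bump_apply_sub_le π ha n _ _).trans_lt ?_
    have := hav i
    rw [hxv i i.2, lt_div_iff₀ (by positivity)] at this
    rw [mul_comm]
    exact_mod_cast this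
  have hgn : ‖g i‖ ≤ 1 := (CStarAlgebra.norm_le_one_iff_of_nonneg _ (hg0 i)).mpr (hg1 i)
  have hpos : 0 ≤ k * g i * k := by
    have := star_left_conjugate_nonneg (hg0 i) k
    rwa [hk.star_eq] at this
  refine ⟨k * g i * k, hpos, ?_, (re_trace_conj_le hτ hk hk1 (hg0 i)).trans_lt hi, ?_⟩
  · rw [← CStarAlgebra.norm_le_one_iff_of_nonneg _ hpos]
    exact (norm_mul_le _ _).trans (mul_le_one₀ ((norm_mul_le _ _).trans
      (mul_le_one₀ hk1 (norm_nonneg _) hgn)) (norm_nonneg _) hk1)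
  -- Follow `u ↦ v_i ↦ v_i ↦ u` through the three factors; each arrow costs `δ / 3`.
  · have h1 : π (k * g i * k) u - u =
        π (k * g i) (π k u - v i) + π k (π (g i) (v i) - v i) + (π k (v i) - u) := by
      simp only [map_mul, mul_apply_eq_comp, map_sub]
      abel
    rw [h1]
    have h2 : ‖π (k * g i) (π k u - v i)‖ ≤ ‖π k u - v i‖ :=
      (π.norm_apply_apply_le _ _).trans (mul_le_of_le_one_left (norm_nonneg _)
        ((norm_mul_le _ _).trans (mul_le_one₀ hk1 (norm_nonneg _) hgn)))
    have h3 : ‖π k (π (g i) (v i) - v i)‖ ≤ ‖π (g i) (v i) - v i‖ :=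
      (π.norm_apply_apply_le _ _).trans (mul_le_of_le_one_left (norm_nonneg _) hk1)
    have h4 := norm_add₃_le (a := π (k * g i) (π k u - v i))
      (b := π k (π (g i) (v i) - v i)) (c := π k (v i) - u)
    linarith

-- In the swap estimate with both vectors equal to `u`, the error vanishes.
omit [PartialOrder A] [StarOrderedRing A] in
theorem boundedTransform_apply_of_apply_eq (π : A →⋆ₐ[ℂ] (H →L[ℂ] H)) {a : A}
    (ha : IsSelfAdjoint a) {u : H} (hu : π a u = u) : π (boundedTransform a) u = u := by
  have h := norm_boundedTransform_apply_sub_le π ha u u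
  rw [hu, sub_self, norm_zero, add_zero] at h
  exact sub_eq_zero.mp (norm_le_zero_iff.mp h)

/-- A positive contraction of small trace that fixes a given vector. -/
theorem IsIrreducibleRep.exists_small_trace (hτ : τ.toLinearMap ∈ traceSpace A)
    {π : A →⋆ₐ[ℂ] (H →L[ℂ] H)} (hπ : IsIrreducibleRep π) (hH : ¬ FiniteDimensional ℂ H)
    (u : H) {ε : ℝ} (hε : 0 < ε) :
    ∃ h : A, 0 ≤ h ∧ h ≤ 1 ∧ (τ h).re < ε ∧ π h u = u := by
  have hone : τ 1 = 1 := hτ.1.2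
  wlog hu : ‖u‖ = 1 generalizing u
  · by_cases hu0 : u = 0
    · subst hu0
      have : Nontrivial A := by
        by_contra h
        rw [not_nontrivial_iff_subsingleton] at h
        rw [Subsingleton.elim (1 : A) 0, map_zero] at hone
        exact zero_ne_one hone
      exact ⟨0, le_rfl, zero_le_one, by simpa using hε, by simp⟩
    · obtain ⟨h, h0, h1, h2, h3⟩ := this (((‖u‖⁻¹ : ℝ) : ℂ) • u) (by
        rw [norm_smul, Complex.norm_real, norm_inv, norm_norm,
          inv_mul_cancel₀ (norm_ne_zero_iff.mpr hu0)])
      refine ⟨h, h0, h1, h2, ?_⟩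
      rw [map_smul] at h3
      refine smul_right_injective H ?_ h3
      simpa using hu0
  -- The final trace is at most `4 τ((h+k)²) ≤ 8 τ(h²) + 8 τ(k²)`. The first term is below `8 * (ε /
  -- 16)`, and `‖k‖ ≤ 6 δ` bounds the second.
  obtain ⟨δ, hδ, hδε⟩ : ∃ δ : ℝ, 0 < δ ∧ 8 * (6 * δ) ^ 2 < ε / 2 := by
    refine ⟨min 1 (ε / 1000), by positivity, ?_⟩
    have h1 : min 1 (ε / 1000) ≤ 1 := min_le_left _ _
    have h2 : min 1 (ε / 1000) ≤ ε / 1000 := min_le_right _ _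
    have h3 : 0 < min 1 (ε / 1000) := by positivity
    nlinarith
  obtain ⟨h, h0, h1, h2, h3⟩ := hπ.exists_small_trace_approx hτ hH hu
    (ε := ε / 16) (by positivity) hδ
  have hsa : IsSelfAdjoint h := h0.isSelfAdjoint
  -- An exact correction: `h + k` fixes `u`. Its bounded transform still does and is a contraction;
  -- squaring makes it positive.
  obtain ⟨k, hk, hkn, hku⟩ := hπ.exists_isSelfAdjoint_apply_eq hu (v := u - π h u) (by
    rw [inner_sub_right, Complex.sub_im, im_inner_apply_self_of_isSelfAdjoint (hsa.map π),
      inner_self_eq_norm_sq_to_K, hu]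
    simp)
  have hs : IsSelfAdjoint (h + k) := hsa.add hk
  have hsu : π (h + k) u = u := by
    rw [map_add, add_apply, hku]; abel
  set b := boundedTransform (h + k)
  have hb : IsSelfAdjoint b := isSelfAdjoint_boundedTransform _
  refine ⟨b * b, hb.mul_self_nonneg,
    mul_self_le_one_of_norm_le_one hb (norm_boundedTransform_le _), ?_, ?_⟩
  · have e1 : b * b ≤ (4 : ℝ) • (h + k) ^ 2 := by
      rw [← sq]; exact boundedTransform_sq_le hs
    have e2 : (h + k) ^ 2 ≤ (2 : ℝ) • (h * h) + (2 : ℝ) • (k * k) := by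
      rw [← sub_nonneg]
      have : (2 : ℝ) • (h * h) + (2 : ℝ) • (k * k) - (h + k) ^ 2 = (h - k) * (h - k) := by
        simp only [two_smul]; noncomm_ring
      rw [this]
      exact (hsa.sub hk).mul_self_nonneg
    have e3 : (τ (h * h)).re ≤ (τ h).re := by
      have := re_trace_conj_le hτ (k := CFC.sqrt h) (CFC.sqrt_nonneg h).isSelfAdjoint
        (by rw [← sq_le_one_iff₀ (norm_nonneg _), sq, ← CStarRing.norm_star_mul_self,
              (CFC.sqrt_nonneg h).isSelfAdjoint.star_eq, CFC.sqrt_mul_sqrt_self h h0]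
            exact (CStarAlgebra.norm_le_one_iff_of_nonneg _ h0).mpr h1) h0
      have e : CFC.sqrt h * h * CFC.sqrt h = h * h := by
        have hr := CFC.sqrt_mul_sqrt_self h h0
        generalize CFC.sqrt h = r at hr
        rw [← hr]
        simp only [mul_assoc]
      rwa [e] at this
    have e4 : (τ (k * k)).re ≤ ‖k‖ ^ 2 := by
      have : k * k ≤ (‖k‖ ^ 2 : ℝ) • (1 : A) := by
        have := IsSelfAdjoint.le_algebraMap_norm_self (a := k * k) hk.mul_self_nonneg.isSelfAdjoint
        rwa [← hk.norm_mul_self, ← Algebra.algebraMap_eq_smul_one]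
      have := re_map_mono τ this
      rwa [re_map_real_smul, hone, Complex.one_re, mul_one] at this
    have e5 := re_map_mono τ e1
    have e6 := re_map_mono τ e2
    rw [re_map_real_smul] at e5
    rw [map_add, Complex.add_re, re_map_real_smul, re_map_real_smul] at e6
    have e7 : ‖k‖ ^ 2 ≤ (6 * δ) ^ 2 := by
      refine pow_le_pow_left₀ (norm_nonneg _) (hkn.trans ?_) 2
      rw [norm_sub_rev]; linarith
    linarith
  · have := boundedTransform_apply_of_apply_eq π hs hsu
    rw [map_mul, mul_apply_eq_comp, this, this]

/-- Finitely many vectors in irreducible infinite-dimensional representations are annihilated by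
positive contractions whose trace is almost one. -/
theorem exists_annihilator_large_trace (hτ : τ.toLinearMap ∈ traceSpace A) {ι : Type*}
    {H : ι → Type*} [∀ j, NormedAddCommGroup (H j)] [∀ j, InnerProductSpace ℂ (H j)]
    [∀ j, CompleteSpace (H j)] (π : ∀ j, A →⋆ₐ[ℂ] (H j →L[ℂ] H j))
    (hπ : ∀ j, IsIrreducibleRep (π j)) (hH : ∀ j, ¬ FiniteDimensional ℂ (H j)) (ξ : ∀ j, H j)
    (s : Finset ι) {ε : ℝ} (hε : 0 < ε) :
    ∃ e : A, 0 ≤ e ∧ e ≤ 1 ∧ (τ (1 - e)).re < ε ∧ ∀ j ∈ s, π j e (ξ j) = 0 := by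
  classical
  induction s using Finset.induction_on generalizing ε with
  | empty =>
    have : (0 : A) ≤ 1 := by simp
    exact ⟨1, this, le_rfl, by simpa using hε, by simp⟩
  | insert j s _ ih =>
    obtain ⟨e, he0, he1, heτ, hes⟩ := ih (ε := ε / 4) (by positivity)
    obtain ⟨h, h0, h1, hhτ, hhu⟩ := (hπ j).exists_small_trace hτ (hH j) (π j e (ξ j))
      (ε := ε / 4) (by positivity)
    have hsa : IsSelfAdjoint e := he0.isSelfAdjoint
    have hen : ‖e‖ ≤ 1 := (CStarAlgebra.norm_le_one_iff_of_nonneg _ he0).mpr he1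
    -- The right factor `e` preserves the earlier annihilations, and `1 - h` kills `π j e (ξ j)`.
    refine ⟨e * (1 - h) * e, ?_, ?_, ?_, ?_⟩
    · have := star_left_conjugate_nonneg (sub_nonneg.mpr h1) e
      rwa [hsa.star_eq] at this
    · have := star_left_conjugate_le_conjugate (sub_le_self (1 : A) h0) e
      rw [hsa.star_eq, mul_one] at this
      exact this.trans (mul_self_le_one_of_norm_le_one hsa hen)
    -- Dropping the negative square, the loss is below `2 * (ε / 4) + ε / 4`.
    · have e1 : 1 - e * (1 - h) * e = (2 : ℝ) • (1 - e) - (1 - e) * (1 - e) + e * h * e := by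
        rw [two_smul]; noncomm_ring
      have e2 := re_map_nonneg τ ((IsSelfAdjoint.one A).sub hsa).mul_self_nonneg
      have e3 := re_trace_conj_le hτ hsa hen h0
      rw [e1, map_add, map_sub, Complex.add_re, Complex.sub_re, re_map_real_smul]
      linarith
    · intro i hi
      rcases Finset.mem_insert.mp hi with rfl | hi
      · simp only [map_mul, map_sub, map_one, mul_apply_eq_comp, sub_apply, one_apply_eq_self, hhu,
          sub_self, map_zero]
      · simp only [map_mul, mul_apply_eq_comp, hes i hi, map_zero]

end Trace

/-! ### Strong closure via finite sets and filters -/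

section StrongClosure

variable {H : Type*} [NormedAddCommGroup H]

theorem mem_closure_of_forall_finset_approx {s : Set (H → H)} {x : H → H}
    (h : ∀ F : Finset H, ∀ ε > 0, ∃ y ∈ s, ∀ v ∈ F, ‖y v - x v‖ < ε) : x ∈ closure s := by
  rw [mem_closure_iff]
  intro o ho hxo
  obtain ⟨F, u, hu, hFo⟩ := isOpen_pi_iff.mp ho x hxo
  have : ∃ ε > 0, ∀ v ∈ F, Metric.ball (x v) ε ⊆ u v := by
    clear h hFo
    induction F using Finset.cons_induction with
    | empty => exact ⟨1, one_pos, by simp⟩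
    | cons w F hw ih =>
      obtain ⟨ε, hε, h1⟩ := ih fun v hv => hu v (Finset.mem_cons_of_mem hv)
      obtain ⟨hopen, hmem⟩ := hu w (Finset.mem_cons_self w F)
      obtain ⟨δ, hδ, h2⟩ := Metric.isOpen_iff.mp hopen _ hmem
      refine ⟨min ε δ, lt_min hε hδ, fun v hv => ?_⟩
      rcases Finset.mem_cons.mp hv with rfl | hv
      · exact (Metric.ball_subset_ball (min_le_right _ _)).trans h2
      · exact (Metric.ball_subset_ball (min_le_left _ _)).trans (h1 v hv)
  obtain ⟨ε, hε, hball⟩ := this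
  obtain ⟨y, hy, hyx⟩ := h F ε hε
  refine ⟨y, hFo fun v hv => hball v hv ?_, hy⟩
  rw [mem_ball_iff_norm]
  exact hyx v hv

variable [InnerProductSpace ℂ H]

theorem isStronglyDenseIn_of_forall_finset_approx [CompleteSpace H] {S : Set (H →L[ℂ] H)}
    {N : VonNeumannAlgebra H} (hS : S ⊆ N)
    (h : ∀ x ∈ N, ∀ F : Finset H, ∀ ε > 0, ∃ y ∈ S, ∀ v ∈ F, ‖y v - x v‖ < ε) :
    IsStronglyDenseIn S N := by
  refine ⟨hS, fun x hx => ?_⟩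
  rw [(PointwiseConvergenceCLM.isEmbedding_coeFn (RingHom.id ℂ) H
    H).isInducing.closure_eq_preimage_closure_image]
  refine mem_closure_of_forall_finset_approx fun F ε hε => ?_
  obtain ⟨y, hy, hyx⟩ := h x hx F ε hε
  exact ⟨_, ⟨_, ⟨y, hy, rfl⟩, rfl⟩, hyx⟩

variable [CompleteSpace H] {A : Type*} [CStarAlgebra A]

theorem exists_approx_of_mem_centralizer_centralizer (π : A →⋆ₐ[ℂ] (H →L[ℂ] H)) {x : H →L[ℂ] H}
    (hx : x ∈ Set.centralizer (Set.centralizer (Set.range π))) (F : Finset H) {ε : ℝ}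
    (hε : 0 < ε) : ∃ a, ∀ v ∈ F, ‖π a v - x v‖ < ε := by
  obtain ⟨_, ⟨a, rfl⟩, ha⟩ := π.range.exists_approx_of_mem_bicommutant (x := x)
    hx (fun v : F => (v : H)) hε
  exact ⟨a, fun v hv => ha ⟨v, hv⟩⟩

/-- Density recast as pointwise convergence, so that identities and estimates on `π(A)` pass to its
bicommutant. No norm bound along the filter is needed. -/
theorem exists_tendsto_of_mem_centralizer_centralizer (π : A →⋆ₐ[ℂ] (H →L[ℂ] H)) {x : H →L[ℂ] H}
    (hx : x ∈ Set.centralizer (Set.centralizer (Set.range π))) :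
    ∃ l : Filter A, l.NeBot ∧ ∀ v, Filter.Tendsto (fun a => π a v) l (nhds (x v)) := by
  have h : (x : H → H) ∈ closure (Set.range fun (a : A) (v : H) => π a v) := by
    refine mem_closure_of_forall_finset_approx fun F ε hε => ?_
    obtain ⟨a, ha⟩ := exists_approx_of_mem_centralizer_centralizer π hx F hε
    exact ⟨_, ⟨a, rfl⟩, ha⟩
  refine ⟨Filter.comap (fun (a : A) (v : H) => π a v) (nhds x), ?_, ?_⟩
  · rw [Filter.comap_neBot_iff]
    intro t ht
    obtain ⟨_, hy, a, rfl⟩ := mem_closure_iff_nhds.mp h t ht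
    exact ⟨a, hy⟩
  · exact tendsto_pi_nhds.mp Filter.tendsto_comap

end StrongClosure

/-! ### Extreme functionals and trivial commutants -/

section Extreme

variable {A : Type*} [CStarAlgebra A] {H : Type*} [NormedAddCommGroup H] [InnerProductSpace ℂ H]
  [CompleteSpace H]

/-- The functional `a ↦ ⟪ξ, T (π a ξ)⟫`. -/
noncomputable def vectorFunctional (π : A →⋆ₐ[ℂ] (H →L[ℂ] H)) (ξ : H) (T : H →L[ℂ] H) :
    A →ₗ[ℂ] ℂ where
  toFun a := inner ℂ ξ (T (π a ξ))
  map_add' a b := by rw [map_add, add_apply, map_add, inner_add_right]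
  map_smul' c a := by rw [map_smul, smul_apply, map_smul, inner_smul_right]; rfl

theorem vectorFunctional_apply (π : A →⋆ₐ[ℂ] (H →L[ℂ] H)) (ξ : H) (T : H →L[ℂ] H) (a : A) :
    vectorFunctional π ξ T a = inner ℂ ξ (T (π a ξ)) := rfl

theorem StarAlgHom.inner_apply_left (π : A →⋆ₐ[ℂ] (H →L[ℂ] H)) (a : A) (u v : H) :
    inner ℂ (π a u) v = inner ℂ u (π (star a) v) := by
  rw [map_star, ContinuousLinearMap.star_eq_adjoint, ContinuousLinearMap.adjoint_inner_right]

/-- Commutation turns the value at `star b * b` into `⟪π b ξ, (1 + R) (π b ξ)⟫`, nonnegative as `‖R‖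
≤ 1`; mean zero keeps the value `1` at the unit. -/
theorem vectorFunctional_mem_stateSpace [PartialOrder A] [StarOrderedRing A]
    (π : A →⋆ₐ[ℂ] (H →L[ℂ] H)) {ξ : H} (hξ : ‖ξ‖ = 1) {R : H →L[ℂ] H} (hR : IsSelfAdjoint R)
    (hR1 : ‖R‖ ≤ 1) (hRξ : inner ℂ ξ (R ξ) = 0) (hcomm : ∀ a, π a * R = R * π a) :
    vectorFunctional π ξ (1 + R) ∈ stateSpace A := by
  refine ⟨fun a ha => ?_, ?_⟩
  · obtain ⟨b, rfl⟩ := CStarAlgebra.nonneg_iff_eq_star_mul_self.mp ha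
    have h1 : vectorFunctional π ξ (1 + R) (star b * b) =
        inner ℂ (π b ξ) (π b ξ) + inner ℂ (π b ξ) (R (π b ξ)) := by
      have h2 : R (π (star b * b) ξ) = π (star b) (R (π b ξ)) := by
        have := congrArg (fun T : H →L[ℂ] H => T (π b ξ)) (hcomm (star b))
        simp only [mul_apply_eq_comp] at this
        rw [this, map_mul, mul_apply_eq_comp]
      rw [vectorFunctional_apply, add_apply, one_apply_eq_self, inner_add_right, h2, map_mul,
        mul_apply_eq_comp, π.inner_apply_left, π.inner_apply_left]
    have him := im_inner_apply_self_of_isSelfAdjoint hR (π b ξ)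
    have hre : -(‖π b ξ‖ ^ 2) ≤ (inner ℂ (π b ξ) (R (π b ξ))).re := by
      have h3 := (Complex.abs_re_le_norm _).trans
        (norm_inner_le_norm (𝕜 := ℂ) (π b ξ) (R (π b ξ)))
      have h4 : ‖R (π b ξ)‖ ≤ ‖π b ξ‖ :=
        (R.le_opNorm _).trans (mul_le_of_le_one_left (norm_nonneg _) hR1)
      have h5 := (abs_le.mp h3).1
      nlinarith [norm_nonneg (π b ξ)]
    rw [h1, inner_self_eq_norm_sq_to_K, Complex.le_def]
    constructor
    · simp only [Complex.zero_re, Complex.add_re, Complex.coe_algebraMap, ← Complex.ofReal_pow,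
        Complex.ofReal_re]
      linarith
    · simp only [Complex.zero_im, Complex.add_im, him, Complex.coe_algebraMap,
        ← Complex.ofReal_pow, Complex.ofReal_im, add_zero]
  · rw [vectorFunctional_apply, map_one, one_apply_eq_self, add_apply, one_apply_eq_self,
      inner_add_right, hRξ, inner_self_eq_norm_sq_to_K, hξ]
    simp

/-- An algebra of operators in the commutant of a cyclic representation is trivial as soon as
the vector functional is extreme among the perturbations that the algebra provides. -/
theorem exists_eq_smul_one_of_mem_extremePoints (π : A →⋆ₐ[ℂ] (H →L[ℂ] H)) {ξ : H}
    (hξ : ‖ξ‖ = 1) (hcyc : DenseRange fun a => π a ξ) {S : Set (A →ₗ[ℂ] ℂ)}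
    (hext : vectorFunctional π ξ 1 ∈ Set.extremePoints ℝ S) (Z : StarSubalgebra ℂ (H →L[ℂ] H))
    (hZ : ∀ T ∈ Z, ∀ a, π a * T = T * π a)
    (hZS : ∀ R ∈ Z, IsSelfAdjoint R → ‖R‖ ≤ 1 → inner ℂ ξ (R ξ) = 0 →
      vectorFunctional π ξ (1 + R) ∈ S) {T : H →L[ℂ] H} (hT : T ∈ Z) :
    ∃ c : ℂ, T = c • (1 : H →L[ℂ] H) := by
  -- The functional of `1` is the midpoint of those of `1 + R` and `1 - R`. Extremality makes the
  -- functional of `R` zero, and cyclicity then gives `R = 0`.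
  have hmean : ∀ R ∈ Z, IsSelfAdjoint R → ‖R‖ ≤ 1 → inner ℂ ξ (R ξ) = 0 → R = 0 := by
    intro R hR hsa h1 h0
    have hplus := hZS R hR hsa h1 h0
    have hminus := hZS (-R) (neg_mem hR) hsa.neg (by rwa [norm_neg])
      (by rw [neg_apply, inner_neg_right, h0, neg_zero])
    have hmid : vectorFunctional π ξ 1 ∈
        openSegment ℝ (vectorFunctional π ξ (1 + R)) (vectorFunctional π ξ (1 + -R)) := by
      refine ⟨1 / 2, 1 / 2, by norm_num, by norm_num, by norm_num, ?_⟩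
      ext a
      simp only [LinearMap.add_apply, LinearMap.smul_apply, vectorFunctional_apply, add_apply,
        neg_apply, inner_add_right, inner_neg_right, one_apply_eq_self, Complex.real_smul]
      push_cast
      ring
    have heq := hext.2 hplus hminus hmid
    have hzero : ∀ a, inner ℂ ξ (R (π a ξ)) = 0 := by
      intro a
      have := congrArg (fun f : A →ₗ[ℂ] ℂ => f a) heq
      simpa [vectorFunctional_apply, inner_add_right] using this
    have hzero' : ∀ a b, inner ℂ (π a ξ) (R (π b ξ)) = 0 := by
      intro a b
      have := congrArg (fun T : H →L[ℂ] H => T (π b ξ)) (hZ R hR (star a))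
      simp only [mul_apply_eq_comp] at this
      rw [π.inner_apply_left, this, show R (π (star a) (π b ξ)) = R (π (star a * b) ξ) by
        rw [map_mul, mul_apply_eq_comp]]
      exact hzero _
    ext v
    refine hcyc.induction_on (p := fun v => R v = (0 : H →L[ℂ] H) v) v
      (isClosed_eq R.continuous continuous_const) fun b => ?_
    refine ext_inner_left ℂ fun w => ?_
    rw [zero_apply, inner_zero_right]
    exact hcyc.induction_on (p := fun w => inner ℂ w (R (π b ξ)) = 0) w
      (isClosed_eq (by fun_prop) continuous_const) fun a => hzero' a b
  have hself : ∀ T ∈ Z, IsSelfAdjoint T → ∃ c : ℂ, T = c • (1 : H →L[ℂ] H) := by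
    intro T hT hsa
    set t : ℝ := (inner ℂ ξ (T ξ)).re
    have ht : inner ℂ ξ (T ξ) = (t : ℂ) :=
      Complex.ext rfl (by rw [im_inner_apply_self_of_isSelfAdjoint hsa, Complex.ofReal_im])
    set U : H →L[ℂ] H := T - (t : ℂ) • 1
    have hUZ : U ∈ Z := sub_mem hT (Z.smul_mem (one_mem Z) _)
    have hUsa : IsSelfAdjoint U :=
      hsa.sub (IsSelfAdjoint.smul (Complex.conj_ofReal t) (.one _))
    have hUξ : inner ℂ ξ (U ξ) = 0 := by
      rw [sub_apply, smul_apply, one_apply_eq_self, inner_sub_right, inner_smul_right, ht,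
        inner_self_eq_norm_sq_to_K, hξ]
      simp
    -- `T` minus its mean, rescaled into the unit ball, meets the hypotheses of `hmean`.
    set r : ℝ := (‖U‖ + 1)⁻¹
    have hr : 0 < r := by positivity
    have hrU := hmean ((r : ℂ) • U) (Z.smul_mem hUZ _)
      (IsSelfAdjoint.smul (Complex.conj_ofReal r) hUsa) (by
        rw [norm_smul, Complex.norm_real, Real.norm_of_nonneg hr.le, inv_mul_le_iff₀ (by positivity)]
        linarith) (by rw [smul_apply, inner_smul_right, hUξ, mul_zero])
    have hU0 : U = 0 := (smul_eq_zero.mp hrU).resolve_left (by exact_mod_cast hr.ne')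
    exact ⟨t, sub_eq_zero.mp hU0⟩
  have hstar : star T ∈ Z := star_mem hT
  have hre : (realPart T : H →L[ℂ] H) ∈ Z := by
    rw [realPart_apply_coe, ← Complex.coe_smul]
    exact Z.smul_mem (add_mem hT hstar) _
  have him : (imaginaryPart T : H →L[ℂ] H) ∈ Z := by
    rw [imaginaryPart_apply_coe, ← Complex.coe_smul]
    exact Z.smul_mem (Z.smul_mem (sub_mem hT hstar) _) _
  obtain ⟨c, hc⟩ := hself _ hre (realPart T).2
  obtain ⟨d, hd⟩ := hself _ him (imaginaryPart T).2
  refine ⟨c + Complex.I * d, ?_⟩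
  rw [add_smul, mul_smul, ← hc, ← hd, realPart_add_I_smul_imaginaryPart]

end Extreme

/-! ### Cyclic tracial vectors and finiteness -/

section TracialVector

variable {A : Type*} [CStarAlgebra A] {H : Type*} [NormedAddCommGroup H] [InnerProductSpace ℂ H]
  [CompleteSpace H] {π : A →⋆ₐ[ℂ] (H →L[ℂ] H)} {ξ : H}

theorem norm_star_apply_of_tracial
    (htr : ∀ a b, inner ℂ ξ (π (a * b) ξ) = inner ℂ ξ (π (b * a) ξ)) (a : A) :
    ‖π (star a) ξ‖ = ‖π a ξ‖ := by
  have h : inner ℂ (π (star a) ξ) (π (star a) ξ) = inner ℂ (π a ξ) (π a ξ) := by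
    rw [π.inner_apply_left, π.inner_apply_left, star_star, ← mul_apply_eq_comp,
      ← mul_apply_eq_comp, ← map_mul, ← map_mul, htr]
  rw [inner_self_eq_norm_sq_to_K, inner_self_eq_norm_sq_to_K] at h
  exact (sq_eq_sq₀ (norm_nonneg _) (norm_nonneg _)).mp (by exact_mod_cast h)

/-- Taking adjoints does not change norms on `ξ`, so `b` can be moved to the outside: `‖π (a b) ξ‖ =
‖π (b⋆ a⋆) ξ‖`. Smallness on `ξ` thus spreads to the dense orbit. -/
theorem norm_apply_apply_le_of_tracial
    (htr : ∀ a b, inner ℂ ξ (π (a * b) ξ) = inner ℂ ξ (π (b * a) ξ)) (a b : A) :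
    ‖π a (π b ξ)‖ ≤ ‖b‖ * ‖π a ξ‖ := by
  rw [← mul_apply_eq_comp, ← map_mul, ← norm_star_apply_of_tracial htr, star_mul, map_mul,
    mul_apply_eq_comp, ← norm_star_apply_of_tracial htr a, ← norm_star b]
  exact π.norm_apply_apply_le _ _

/-- Approximating `z` by `c` in `A`, pass `τ(c a b) = τ(b c a)` to the limit, then move `z` past
`b`. -/
theorem vectorFunctional_tracial_of_central
    (htr : ∀ a b, inner ℂ ξ (π (a * b) ξ) = inner ℂ ξ (π (b * a) ξ)) {z : H →L[ℂ] H}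
    (hz : z ∈ Set.centralizer (Set.centralizer (Set.range π)))
    (hcomm : ∀ a, π a * z = z * π a) (a b : A) :
    vectorFunctional π ξ z (a * b) = vectorFunctional π ξ z (b * a) := by
  obtain ⟨l, hl, hlim⟩ := exists_tendsto_of_mem_centralizer_centralizer π hz
  have h1 : Filter.Tendsto (fun c => inner ℂ ξ (π c (π (a * b) ξ))) l
      (nhds (vectorFunctional π ξ z (a * b))) := tendsto_const_nhds.inner (hlim _)
  have h2 : Filter.Tendsto (fun c => inner ℂ (π (star b) ξ) (π c (π a ξ))) l
      (nhds (inner ℂ (π (star b) ξ) (z (π a ξ)))) := tendsto_const_nhds.inner (hlim _)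
  have h3 : ∀ c, inner ℂ ξ (π c (π (a * b) ξ)) = inner ℂ (π (star b) ξ) (π c (π a ξ)) := by
    intro c
    rw [π.inner_apply_left, star_star]
    simp only [← mul_apply_eq_comp, ← map_mul]
    rw [← mul_assoc, htr]
  have h4 : inner ℂ (π (star b) ξ) (z (π a ξ)) = vectorFunctional π ξ z (b * a) := by
    have := congrArg (fun T : H →L[ℂ] H => T (π a ξ)) (hcomm b)
    simp only [mul_apply_eq_comp] at this
    rw [π.inner_apply_left, star_star, this, vectorFunctional_apply, map_mul, mul_apply_eq_comp]
  rw [← h4]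
  exact tendsto_nhds_unique (h1.congr h3) h2

/-- In particular `x ξ = 0` forces `x = 0` by cyclicity: `ξ` is separating. -/
theorem norm_apply_apply_le_of_mem_bicommutant
    (htr : ∀ a b, inner ℂ ξ (π (a * b) ξ) = inner ℂ ξ (π (b * a) ξ)) {x : H →L[ℂ] H}
    (hx : x ∈ Set.centralizer (Set.centralizer (Set.range π))) (b : A) :
    ‖x (π b ξ)‖ ≤ ‖b‖ * ‖x ξ‖ := by
  obtain ⟨l, hl, hlim⟩ := exists_tendsto_of_mem_centralizer_centralizer π hx
  exact le_of_tendsto_of_tendsto' (hlim _).norm ((hlim _).norm.const_mul _)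
    fun c => norm_apply_apply_le_of_tracial htr c b

/-- The adjoint is not strongly continuous, so `star x ξ` is tested against the orbit vectors `π a
ξ`, where `⟪ξ, π (c a) ξ⟫ = ⟪π (star a) ξ, π c ξ⟫` involves only the convergent `π c ξ`. -/
theorem norm_adjoint_apply_le_of_mem_bicommutant (hcyc : DenseRange fun a => π a ξ)
    (htr : ∀ a b, inner ℂ ξ (π (a * b) ξ) = inner ℂ ξ (π (b * a) ξ)) {x : H →L[ℂ] H}
    (hx : x ∈ Set.centralizer (Set.centralizer (Set.range π))) :
    ‖star x ξ‖ ≤ ‖x ξ‖ := by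
  obtain ⟨l, hl, hlim⟩ := exists_tendsto_of_mem_centralizer_centralizer π hx
  have h1 : ∀ a, ‖inner ℂ (π a ξ) (star x ξ)‖ ≤ ‖π a ξ‖ * ‖x ξ‖ := by
    intro a
    rw [ContinuousLinearMap.star_eq_adjoint, ContinuousLinearMap.adjoint_inner_right,
      norm_inner_symm]
    refine le_of_tendsto_of_tendsto' ((tendsto_const_nhds.inner (hlim _)).norm)
      ((hlim ξ).norm.const_mul ‖π a ξ‖) fun c => ?_
    have h2 : inner ℂ ξ (π c (π a ξ)) = inner ℂ (π (star a) ξ) (π c ξ) := by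
      rw [π.inner_apply_left, star_star]
      simp only [← mul_apply_eq_comp, ← map_mul]
      exact htr _ _
    rw [h2, ← norm_star_apply_of_tracial htr a]
    exact norm_inner_le_norm _ _
  have h2 : ∀ w, ‖inner ℂ w (star x ξ)‖ ≤ ‖w‖ * ‖x ξ‖ := fun w =>
    hcyc.induction_on (p := fun w => ‖inner ℂ w (star x ξ)‖ ≤ ‖w‖ * ‖x ξ‖) w
      (isClosed_le (by fun_prop) (by fun_prop)) h1
  have h3 := h2 (star x ξ)
  rw [inner_self_eq_norm_sq_to_K, norm_pow, RCLike.norm_ofReal, abs_norm, sq] at h3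
  by_cases h0 : ‖star x ξ‖ = 0
  · rw [h0]; exact norm_nonneg _
  · exact le_of_mul_le_mul_left h3 ((norm_nonneg _).lt_of_ne' h0)

/-- In the von Neumann algebra of a cyclic tracial vector every isometry is unitary. -/
theorem mul_star_eq_one_of_tracial (hcyc : DenseRange fun a => π a ξ)
    (htr : ∀ a b, inner ℂ ξ (π (a * b) ξ) = inner ℂ ξ (π (b * a) ξ)) {N : VonNeumannAlgebra H}
    (hN : (N : Set (H →L[ℂ] H)) = Set.centralizer (Set.centralizer (Set.range π)))
    {v : H →L[ℂ] H} (hv : v ∈ N) (hiso : star v * v = 1) : v * star v = 1 := by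
  have hmem : ∀ x ∈ N, x ∈ Set.centralizer (Set.centralizer (Set.range π)) := fun x hx => by
    rw [← hN]; exact hx
  have hnorm : ‖star v ξ‖ = ‖ξ‖ := by
    have h1 := norm_adjoint_apply_le_of_mem_bicommutant hcyc htr (hmem v hv)
    have h2 := norm_adjoint_apply_le_of_mem_bicommutant hcyc htr (hmem _ (star_mem hv))
    rw [star_star] at h2
    have h3 : ‖v ξ‖ = ‖ξ‖ := by
      have h4 : inner ℂ (v ξ) (v ξ) = inner ℂ ξ ξ := by
        rw [← ContinuousLinearMap.adjoint_inner_right, ← ContinuousLinearMap.star_eq_adjoint,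
          ← mul_apply_eq_comp, hiso, one_apply_eq_self]
      rw [inner_self_eq_norm_sq_to_K, inner_self_eq_norm_sq_to_K] at h4
      exact (sq_eq_sq₀ (norm_nonneg _) (norm_nonneg _)).mp (by exact_mod_cast h4)
    exact (h1.antisymm h2).trans h3
  -- Both vectors have norm `‖ξ‖` and their inner product is `‖ξ‖²`, the equality case of
  -- Cauchy–Schwarz.
  have hfix : v (star v ξ) = ξ := by
    have h1 : ‖v (star v ξ)‖ = ‖ξ‖ := by
      have h4 : inner ℂ (v (star v ξ)) (v (star v ξ)) = inner ℂ (star v ξ) (star v ξ) := by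
        rw [← ContinuousLinearMap.adjoint_inner_right, ← ContinuousLinearMap.star_eq_adjoint,
          ← mul_apply_eq_comp, hiso, one_apply_eq_self]
      rw [inner_self_eq_norm_sq_to_K, inner_self_eq_norm_sq_to_K] at h4
      exact ((sq_eq_sq₀ (norm_nonneg _) (norm_nonneg _)).mp (by exact_mod_cast h4)).trans hnorm
    have h2 : inner ℂ (v (star v ξ)) ξ = ((‖ξ‖ ^ 2 : ℝ) : ℂ) := by
      rw [← ContinuousLinearMap.adjoint_inner_right, ← ContinuousLinearMap.star_eq_adjoint,
        inner_self_eq_norm_sq_to_K, hnorm]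
      simp
    have h3 := norm_sub_sq (𝕜 := ℂ) (v (star v ξ)) ξ
    rw [h2, h1] at h3
    simp only [RCLike.re_to_complex, Complex.ofReal_re] at h3
    have h4 : ‖v (star v ξ) - ξ‖ ^ 2 = 0 := by rw [h3]; ring
    exact sub_eq_zero.mp (norm_eq_zero.mp (pow_eq_zero_iff (two_ne_zero) |>.mp h4))
  have hx : v * star v - 1 ∈ N := sub_mem (mul_mem hv (star_mem hv)) (one_mem N)
  have hzero : (v * star v - 1) ξ = 0 := by
    rw [sub_apply, mul_apply_eq_comp, hfix, one_apply_eq_self, sub_self]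
  refine sub_eq_zero.mp (ContinuousLinearMap.ext fun w => ?_)
  refine hcyc.induction_on (p := fun w => (v * star v - 1) w = (0 : H →L[ℂ] H) w) w
    (isClosed_eq (v * star v - 1).continuous continuous_const) fun b => ?_
  have := norm_apply_apply_le_of_mem_bicommutant htr (hmem _ hx) b
  rw [hzero, norm_zero, mul_zero] at this
  exact norm_le_zero_iff.mp this

end TracialVector

/-! ### GNS representations of pure states and extremal traces -/

section GNS

variable {A : Type*} [CStarAlgebra A] [PartialOrder A] [StarOrderedRing A] (φ : A →ₚ[ℂ] ℂ)

theorem gnsStarAlgHom_apply_gnsVector (a : A) :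
    φ.gnsStarAlgHom a (gnsVector φ) = ((φ.toPreGNS a : φ.PreGNS) : φ.GNS) := by
  have h : φ.gnsNonUnitalStarAlgHom a ((φ.toPreGNS 1 : φ.PreGNS) : φ.GNS) = _ :=
    φ.gnsNonUnitalStarAlgHom_apply_coe
  rw [PositiveLinearMap.leftMulMapPreGNS_apply, PositiveLinearMap.ofPreGNS_toPreGNS, mul_one] at h
  exact h

theorem denseRange_gnsStarAlgHom_apply_gnsVector :
    DenseRange fun a => φ.gnsStarAlgHom a (gnsVector φ) := by
  simp only [gnsStarAlgHom_apply_gnsVector]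
  exact UniformSpace.Completion.denseRange_coe.comp φ.toPreGNS.surjective.denseRange
    (UniformSpace.Completion.continuous_coe _)

theorem inner_gnsStarAlgHom_apply_gnsVector (a b : A) :
    inner ℂ (φ.gnsStarAlgHom a (gnsVector φ)) (φ.gnsStarAlgHom b (gnsVector φ)) =
      φ (star a * b) := by
  rw [gnsStarAlgHom_apply_gnsVector, gnsStarAlgHom_apply_gnsVector,
    UniformSpace.Completion.inner_coe, PositiveLinearMap.preGNS_inner_def]
  rfl

theorem inner_gnsVector_gnsStarAlgHom_apply (a : A) :
    inner ℂ (gnsVector φ) (φ.gnsStarAlgHom a (gnsVector φ)) = φ a := by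
  have h := inner_gnsStarAlgHom_apply_gnsVector φ 1 a
  rwa [map_one, one_apply_eq_self, star_one, one_mul] at h

variable {φ}

theorem norm_gnsVector (hφ : φ.toLinearMap ∈ stateSpace A) : ‖gnsVector φ‖ = 1 := by
  have h := inner_gnsVector_gnsStarAlgHom_apply φ 1
  have h1 : φ 1 = 1 := hφ.2
  have h2 := inner_self_eq_norm_sq (𝕜 := ℂ) (gnsVector φ)
  rw [map_one, one_apply_eq_self, h1] at h
  rw [h, RCLike.one_re] at h2
  exact (pow_eq_one_iff_of_nonneg (norm_nonneg _) two_ne_zero).mp h2.symm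

theorem vectorFunctional_gnsVector :
    vectorFunctional φ.gnsStarAlgHom (gnsVector φ) 1 = φ.toLinearMap := by
  ext a
  rw [vectorFunctional_apply, one_apply_eq_self, inner_gnsVector_gnsStarAlgHom_apply]
  rfl

theorem gnsStarAlgHom_apply_gnsVector_eq_zero_iff (a : A) :
    φ.gnsStarAlgHom a (gnsVector φ) = 0 ↔ φ (star a * a) = 0 := by
  rw [← inner_gnsStarAlgHom_apply_gnsVector, inner_self_eq_zero]

/-- The GNS representation of a pure state is irreducible. -/
theorem IsPureState.isIrreducibleRep (hφ : IsPureState φ) : IsIrreducibleRep φ.gnsStarAlgHom := by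
  intro T hT
  have hξ := norm_gnsVector hφ.1
  have hmem : ∀ T : φ.GNS →L[ℂ] φ.GNS,
      T ∈ StarSubalgebra.centralizer ℂ (Set.range φ.gnsStarAlgHom) ↔
        ∀ a, φ.gnsStarAlgHom a * T = T * φ.gnsStarAlgHom a := by
    intro T
    rw [StarSubalgebra.mem_centralizer_iff]
    refine ⟨fun h a => (h _ ⟨a, rfl⟩).1, ?_⟩
    rintro h _ ⟨a, rfl⟩
    exact ⟨h a, by rw [← map_star]; exact h _⟩
  refine exists_eq_smul_one_of_mem_extremePoints φ.gnsStarAlgHom hξ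
    (denseRange_gnsStarAlgHom_apply_gnsVector φ) (S := stateSpace A)
    (by rw [vectorFunctional_gnsVector]; exact hφ)
    (StarSubalgebra.centralizer ℂ (Set.range φ.gnsStarAlgHom)) (fun T hT => (hmem T).mp hT)
    (fun R hR hsa h1 h0 => vectorFunctional_mem_stateSpace _ hξ hsa h1 h0 ((hmem R).mp hR))
    ((hmem T).mpr hT)

theorem tracial_gnsVector (hφ : φ.toLinearMap ∈ traceSpace A) (a b : A) :
    inner ℂ (gnsVector φ) (φ.gnsStarAlgHom (a * b) (gnsVector φ)) =
      inner ℂ (gnsVector φ) (φ.gnsStarAlgHom (b * a) (gnsVector φ)) := by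
  rw [inner_gnsVector_gnsStarAlgHom_apply, inner_gnsVector_gnsStarAlgHom_apply]
  exact hφ.2 a b

theorem gnsStarAlgHom_mem_gnsVonNeumannAlgebra (a : A) :
    φ.gnsStarAlgHom a ∈ gnsVonNeumannAlgebra φ := by
  rw [← SetLike.mem_coe, coe_gnsVonNeumannAlgebra]
  exact Set.subset_centralizer_centralizer ⟨a, rfl⟩

/-- Perturbing by central elements stays inside the trace space, so extremality there kills the
centre. -/
theorem IsExtremalTrace.exists_eq_smul_one (hφ : IsExtremalTrace φ) {x : φ.GNS →L[ℂ] φ.GNS}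
    (hx : x ∈ gnsVonNeumannAlgebra φ) (hx' : x ∈ (gnsVonNeumannAlgebra φ).commutant) :
    ∃ c : ℂ, x = c • (1 : φ.GNS →L[ℂ] φ.GNS) := by
  have hξ := norm_gnsVector hφ.1.1
  have hcomm : ∀ T ∈ (gnsVonNeumannAlgebra φ).commutant, ∀ a,
      φ.gnsStarAlgHom a * T = T * φ.gnsStarAlgHom a := fun T hT a =>
    VonNeumannAlgebra.mem_commutant_iff.mp hT _ (gnsStarAlgHom_mem_gnsVonNeumannAlgebra a)
  refine exists_eq_smul_one_of_mem_extremePoints φ.gnsStarAlgHom hξ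
    (denseRange_gnsStarAlgHom_apply_gnsVector φ) (S := traceSpace A)
    (by rw [vectorFunctional_gnsVector]; exact hφ)
    ((gnsVonNeumannAlgebra φ).toStarSubalgebra ⊓
      (gnsVonNeumannAlgebra φ).commutant.toStarSubalgebra)
    (fun T hT => hcomm T hT.2) (fun R hR hsa h1 h0 =>
      ⟨vectorFunctional_mem_stateSpace _ hξ hsa h1 h0 (hcomm R hR.2), ?_⟩) ⟨hx, hx'⟩
  have h1R : 1 + R ∈ Set.centralizer (Set.centralizer (Set.range φ.gnsStarAlgHom)) := by
    rw [← coe_gnsVonNeumannAlgebra]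
    exact add_mem (one_mem (gnsVonNeumannAlgebra φ)) hR.1
  exact vectorFunctional_tracial_of_central (tracial_gnsVector hφ.1) h1R fun a => by
    rw [mul_add, add_mul, mul_one, one_mul, hcomm R hR.2]

omit [PartialOrder A] [StarOrderedRing A] in
theorem injective_of_isSimple (hA : IsSimpleCStarAlgebra A) {H : Type*} [NormedAddCommGroup H]
    [InnerProductSpace ℂ H] [CompleteSpace H] [Nontrivial H] (π : A →⋆ₐ[ℂ] (H →L[ℂ] H)) :
    Function.Injective π := by
  have hcont : Continuous π := AddMonoidHomClass.continuous_of_bound π 1 fun a => by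
    rw [one_mul]; exact NonUnitalStarAlgHom.norm_apply_le π a
  have hclosed : IsClosed (TwoSidedIdeal.ker π : Set A) := by
    have : (TwoSidedIdeal.ker π : Set A) = π ⁻¹' {0} := by
      ext a; exact TwoSidedIdeal.mem_ker π
    rw [this]
    exact isClosed_singleton.preimage hcont
  rcases hA.2 _ hclosed with h | h
  · rw [injective_iff_map_eq_zero]
    intro a ha
    have : a ∈ TwoSidedIdeal.ker π := (TwoSidedIdeal.mem_ker π).mpr ha
    rw [h] at this
    exact (TwoSidedIdeal.mem_bot A).mp this
  · have h1 : (1 : A) ∈ TwoSidedIdeal.ker π := by rw [h]; trivial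
    have h2 := (TwoSidedIdeal.mem_ker π).mp h1
    rw [map_one] at h2
    exact absurd h2 one_ne_zero

theorem injective_gnsStarAlgHom (hA : IsSimpleCStarAlgebra A)
    (hφ : φ.toLinearMap ∈ stateSpace A) : Function.Injective φ.gnsStarAlgHom := by
  have : Nontrivial φ.GNS := ⟨gnsVector φ, 0, fun h => by
    have := norm_gnsVector hφ
    rw [h, norm_zero] at this
    exact zero_ne_one this⟩
  exact injective_of_isSimple hA _

theorem not_finiteDimensional_gns (hA : IsSimpleCStarAlgebra A) (hinf : ¬ FiniteDimensional ℂ A)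
    (hφ : φ.toLinearMap ∈ stateSpace A) : ¬ FiniteDimensional ℂ φ.GNS := by
  intro h
  have : FiniteDimensional ℂ (φ.GNS →L[ℂ] φ.GNS) := inferInstance
  exact hinf (FiniteDimensional.of_injective
    (φ.gnsStarAlgHom.toAlgHom.toLinearMap) (injective_gnsStarAlgHom hA hφ))

theorem IsExtremalTrace.isFactorOfTypeII₁ (hA : IsSimpleCStarAlgebra A)
    (hinf : ¬ FiniteDimensional ℂ A) (hφ : IsExtremalTrace φ) :
    IsFactorOfTypeII₁ (gnsVonNeumannAlgebra φ) where
  factor _ hx hx' := hφ.exists_eq_smul_one hx hx'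
  finite _ hv hiso := mul_star_eq_one_of_tracial (denseRange_gnsStarAlgHom_apply_gnsVector φ)
    (tracial_gnsVector hφ.1) (coe_gnsVonNeumannAlgebra φ) hv hiso
  infiniteDimensional h := by
    let f : A →ₗ[ℂ] (gnsVonNeumannAlgebra φ).toStarSubalgebra :=
      { toFun := fun a => ⟨φ.gnsStarAlgHom a, gnsStarAlgHom_mem_gnsVonNeumannAlgebra a⟩
        map_add' := fun a b => Subtype.ext (map_add _ a b)
        map_smul' := fun c a => Subtype.ext (map_smul _ c a) }
    exact hinf (FiniteDimensional.of_injective f fun a b hab =>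
      injective_gnsStarAlgHom hA hφ.1.1 (congrArg Subtype.val hab))

end GNS

/-! ### The hereditary subalgebra and its strong density -/

section Annihilator

variable {A : Type*} [CStarAlgebra A] [PartialOrder A] [StarOrderedRing A] {m : ℕ}

theorem isHereditaryCStarSubalgebra_gnsAnnihilator (φ : Fin m → (A →ₚ[ℂ] ℂ)) :
    IsHereditaryCStarSubalgebra (gnsAnnihilator φ) := by
  refine ⟨⟨{ carrier := gnsAnnihilator φ
             add_mem' := fun {a b} ha hb j => ?_
             zero_mem' := fun j => ?_
             mul_mem' := fun {a b} ha hb j => ?_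
             smul_mem' := fun c a ha j => ?_
             star_mem' := fun {a} ha j => ?_ }, rfl⟩, ?_, ?_⟩
  · rw [star_add, map_add, map_add, add_apply, add_apply, (ha j).1, (ha j).2, (hb j).1, (hb j).2,
      add_zero]
    exact ⟨rfl, rfl⟩
  · rw [star_zero, map_zero, zero_apply]; exact ⟨rfl, rfl⟩
  · rw [star_mul, map_mul, map_mul, mul_apply_eq_comp, mul_apply_eq_comp, (hb j).1, (ha j).2,
      map_zero, map_zero]
    exact ⟨rfl, rfl⟩
  · rw [star_smul, map_smul, map_smul, smul_apply, smul_apply, (ha j).1, (ha j).2, smul_zero,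
      smul_zero]
    exact ⟨rfl, rfl⟩
  · rw [star_star]; exact ⟨(ha j).2, (ha j).1⟩
  · have hcont : ∀ j, Continuous fun a => (φ j).gnsStarAlgHom a (gnsVector (φ j)) := fun j =>
      (AddMonoidHomClass.continuous_of_bound (φ j).gnsStarAlgHom 1 fun a => by
        rw [one_mul]; exact NonUnitalStarAlgHom.norm_apply_le (φ j).gnsStarAlgHom a).clm_apply
          continuous_const
    simp only [gnsAnnihilator, Set.ofPred_forall, Set.ofPred_and]
    exact isClosed_iInter fun j => (isClosed_eq (hcont j) continuous_const).inter
      (isClosed_eq ((hcont j).comp continuous_star) continuous_const)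
  -- From `0 ≤ φ j a ≤ φ j b = 0`, the square root of `a` kills the GNS vector, hence so does `a`.
  · intro a b ha hab hb j
    have hb0 : φ j b = 0 := by
      rw [← inner_gnsVector_gnsStarAlgHom_apply, (hb j).1, inner_zero_right]
    have ha0 : φ j a = 0 :=
      le_antisymm (hb0 ▸ OrderHomClass.mono (φ j) hab) ((φ j).map_nonneg ha)
    have hr : IsSelfAdjoint (CFC.sqrt a) := (CFC.sqrt_nonneg a).isSelfAdjoint
    have hzero : (φ j).gnsStarAlgHom a (gnsVector (φ j)) = 0 := by
      have h1 : (φ j).gnsStarAlgHom (CFC.sqrt a) (gnsVector (φ j)) = 0 := by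
        rw [gnsStarAlgHom_apply_gnsVector_eq_zero_iff, hr.star_eq, CFC.sqrt_mul_sqrt_self a ha, ha0]
      rw [← CFC.sqrt_mul_sqrt_self a ha, map_mul, mul_apply_eq_comp, h1, map_zero]
    exact ⟨hzero, by rw [ha.isSelfAdjoint.star_eq]; exact hzero⟩

theorem mul_mul_mem_gnsAnnihilator {φ : Fin m → (A →ₚ[ℂ] ℂ)} {e : A} (he : IsSelfAdjoint e)
    (hφ : ∀ j, (φ j).gnsStarAlgHom e (gnsVector (φ j)) = 0) (a : A) :
    e * a * e ∈ gnsAnnihilator φ := by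
  intro j
  rw [star_mul, star_mul, he.star_eq]
  simp only [map_mul, mul_apply_eq_comp, hφ j, map_zero, and_self]

theorem norm_gnsStarAlgHom_one_sub_apply_sq_le {τ : A →ₚ[ℂ] ℂ}
    {e : A} (he0 : 0 ≤ e) (he1 : e ≤ 1) :
    ‖τ.gnsStarAlgHom (1 - e) (gnsVector τ)‖ ^ 2 ≤ (τ (1 - e)).re := by
  set f := 1 - e
  have hf0 : 0 ≤ f := sub_nonneg.mpr he1
  have hff : f * f ≤ f := by
    -- Holds because `e + f = 1`; both summands are visibly positive.
    have h1 : f - f * f = f * e * f + e * f * e := by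
      simp only [f]; noncomm_ring
    have hsaf := hf0.isSelfAdjoint
    have hsae := he0.isSelfAdjoint
    have h2 := star_left_conjugate_nonneg he0 f
    have h3 := star_left_conjugate_nonneg hf0 e
    rw [hsaf.star_eq] at h2
    rw [hsae.star_eq] at h3
    rw [← sub_nonneg, h1]
    exact add_nonneg h2 h3
  have h := inner_gnsStarAlgHom_apply_gnsVector τ f f
  rw [hf0.isSelfAdjoint.star_eq] at h
  have h2 : ‖τ.gnsStarAlgHom f (gnsVector τ)‖ ^ 2 = (τ (f * f)).re := by
    rw [← h]
    exact (inner_self_eq_norm_sq (𝕜 := ℂ) _).symm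
  rw [h2]
  exact re_map_mono τ hff

theorem exists_approximate_one {τ : A →ₚ[ℂ] ℂ} (hτ : τ.toLinearMap ∈ traceSpace A) {P : A → Prop}
    (hP : ∀ ε > 0, ∃ e : A, 0 ≤ e ∧ e ≤ 1 ∧ (τ (1 - e)).re < ε ∧ P e) (F : Finset τ.GNS) {ε : ℝ}
    (hε : 0 < ε) :
    ∃ e : A, 0 ≤ e ∧ e ≤ 1 ∧ P e ∧ ∀ v ∈ F, ‖τ.gnsStarAlgHom (1 - e) v‖ < ε := by
  choose b hb using fun v : τ.GNS =>
    (denseRange_gnsStarAlgHom_apply_gnsVector τ).exists_dist_lt v (half_pos hε)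
  set C : ℝ := ∑ v ∈ F, ‖b v‖
  have hC : 0 ≤ C := Finset.sum_nonneg fun _ _ => norm_nonneg _
  obtain ⟨e, he0, he1, heτ, hPe⟩ := hP ((ε / (2 * (C + 1))) ^ 2) (by positivity)
  refine ⟨e, he0, he1, hPe, fun v hv => ?_⟩
  have hξ : ‖τ.gnsStarAlgHom (1 - e) (gnsVector τ)‖ < ε / (2 * (C + 1)) :=
    lt_of_pow_lt_pow_left₀ 2 (by positivity)
      ((norm_gnsStarAlgHom_one_sub_apply_sq_le he0 he1).trans_lt heτ)
  have hn : ‖1 - e‖ ≤ 1 := (CStarAlgebra.norm_le_one_iff_of_nonneg _ (sub_nonneg.mpr he1)).mpr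
    (sub_le_self _ he0)
  have hbC : ‖b v‖ ≤ C := Finset.single_le_sum (f := fun v => ‖b v‖)
    (fun _ _ => norm_nonneg _) hv
  have h1 : τ.gnsStarAlgHom (1 - e) v =
      τ.gnsStarAlgHom (1 - e) (v - τ.gnsStarAlgHom (b v) (gnsVector τ)) +
        τ.gnsStarAlgHom (1 - e) (τ.gnsStarAlgHom (b v) (gnsVector τ)) := by
    rw [← map_add, sub_add_cancel]
  have h2 : ‖τ.gnsStarAlgHom (1 - e) (v - τ.gnsStarAlgHom (b v) (gnsVector τ))‖ < ε / 2 := by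
    refine (StarAlgHom.norm_apply_apply_le _ _ _).trans_lt
      ((mul_le_of_le_one_left (norm_nonneg _) hn).trans_lt ?_)
    rw [← dist_eq_norm]
    exact hb v
  have h3 : ‖τ.gnsStarAlgHom (1 - e) (τ.gnsStarAlgHom (b v) (gnsVector τ))‖ ≤ ε / 2 := by
    refine (norm_apply_apply_le_of_tracial (tracial_gnsVector hτ) _ _).trans ?_
    have h4 : ‖b v‖ * ‖τ.gnsStarAlgHom (1 - e) (gnsVector τ)‖ ≤
        (C + 1) * (ε / (2 * (C + 1))) := by gcongr; linarith
    refine h4.trans_eq ?_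
    field_simp
  rw [h1]
  exact (norm_add_le _ _).trans_lt (by linarith)

theorem isStronglyDenseIn_gnsAnnihilator (hA : IsSimpleCStarAlgebra A)
    (hinf : ¬ FiniteDimensional ℂ A) {τ : A →ₚ[ℂ] ℂ} (hτ : τ.toLinearMap ∈ traceSpace A)
    {φ : Fin m → (A →ₚ[ℂ] ℂ)} (hφ : ∀ j, IsPureState (φ j)) :
    IsStronglyDenseIn (τ.gnsStarAlgHom '' gnsAnnihilator φ) (gnsVonNeumannAlgebra τ) := by
  classical
  refine isStronglyDenseIn_of_forall_finset_approx ?_ fun x hx F ε hε => ?_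
  · rintro _ ⟨a, -, rfl⟩
    exact gnsStarAlgHom_mem_gnsVonNeumannAlgebra a
  obtain ⟨a, ha⟩ := exists_approx_of_mem_centralizer_centralizer τ.gnsStarAlgHom (x := x)
    (by rw [← coe_gnsVonNeumannAlgebra]; exact hx) F (half_pos hε)
  obtain ⟨e, he0, he1, hes, he⟩ := exists_approximate_one hτ
    (P := fun e => ∀ j, (φ j).gnsStarAlgHom e (gnsVector (φ j)) = 0)
    (fun δ hδ => by
      obtain ⟨e, h0, h1, h2, h3⟩ := exists_annihilator_large_trace hτ
        (fun j => (φ j).gnsStarAlgHom) (fun j => (hφ j).isIrreducibleRep)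
        (fun j => not_finiteDimensional_gns hA hinf (hφ j).1) (fun j => gnsVector (φ j))
        Finset.univ hδ
      exact ⟨e, h0, h1, h2, fun j => h3 j (Finset.mem_univ j)⟩)
    -- `e` must be close to `1` on `F` for its right occurrence in `e * a * e`, and on `π_τ(a) F`
    -- for the left one.
    (F ∪ F.image (τ.gnsStarAlgHom a)) (ε := ε / (2 * (‖a‖ + 1))) (by positivity)
  refine ⟨_, ⟨_, mul_mul_mem_gnsAnnihilator he0.isSelfAdjoint hes a, rfl⟩, fun v hv => ?_⟩
  have hen : ‖e‖ ≤ 1 := (CStarAlgebra.norm_le_one_iff_of_nonneg _ he0).mpr he1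
  have h1 : τ.gnsStarAlgHom (e * a * e) v - x v =
      (τ.gnsStarAlgHom a v - x v) - τ.gnsStarAlgHom (1 - e) (τ.gnsStarAlgHom a v) -
        τ.gnsStarAlgHom (e * a) (τ.gnsStarAlgHom (1 - e) v) := by
    simp only [map_mul, map_sub, map_one, mul_apply_eq_comp, sub_apply, one_apply_eq_self]
    abel
  have h2 := ha v hv
  have h3 := he _ (Finset.mem_union_right _ (Finset.mem_image_of_mem _ hv))
  have h4 : ‖τ.gnsStarAlgHom (e * a) (τ.gnsStarAlgHom (1 - e) v)‖ ≤
      ‖a‖ * (ε / (2 * (‖a‖ + 1))) := by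
    refine (StarAlgHom.norm_apply_apply_le _ _ _).trans (mul_le_mul ?_
      (he v (Finset.mem_union_left _ hv)).le (norm_nonneg _) (norm_nonneg _))
    exact (norm_mul_le _ _).trans (mul_le_of_le_one_left (norm_nonneg _) hen)
  have h5 : ‖a‖ * (ε / (2 * (‖a‖ + 1))) + ε / (2 * (‖a‖ + 1)) = ε / 2 := by
    field_simp
  rw [h1]
  have h6 := norm_sub_le (τ.gnsStarAlgHom a v - x v -
    τ.gnsStarAlgHom (1 - e) (τ.gnsStarAlgHom a v))
    (τ.gnsStarAlgHom (e * a) (τ.gnsStarAlgHom (1 - e) v))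
  have h7 := norm_sub_le (τ.gnsStarAlgHom a v - x v)
    (τ.gnsStarAlgHom (1 - e) (τ.gnsStarAlgHom a v))
  linarith

end Annihilator

theorem mainTheorem10 {A : Type*} [CStarAlgebra A] [PartialOrder A] [StarOrderedRing A]
    (hsimple : IsSimpleCStarAlgebra A) (hinf : ¬ FiniteDimensional ℂ A)
    (τ : A →ₚ[ℂ] ℂ) (hτ : IsExtremalTrace τ)
    {m : ℕ} (φ : Fin m → (A →ₚ[ℂ] ℂ)) (hφ : ∀ j, IsPureState (φ j)) :
    IsHereditaryCStarSubalgebra (gnsAnnihilator φ) ∧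
      IsFactorOfTypeII₁ (gnsVonNeumannAlgebra τ) ∧
      IsStronglyDenseIn (τ.gnsStarAlgHom '' gnsAnnihilator φ) (gnsVonNeumannAlgebra τ) :=
  ⟨isHereditaryCStarSubalgebra_gnsAnnihilator φ, hτ.isFactorOfTypeII₁ hsimple hinf,
    isStronglyDenseIn_gnsAnnihilator hsimple hinf hτ.1 hφ⟩
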